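/- Let $P(X)=X^d+a_{d-1}X^{d-1}+\cdots+a_0\in\mathbb Z[X]$ be a monic polynomial of degree $d\ge 1$ without multiple roots that is expanding, i.e. all its complex roots $\alpha_1,\dots,\alpha_d$ satisfy $|\alpha_i|>1$. Let $\|x\|$ denote the distance from $x\in\mathbb R$ to the nearest integer, let $\Xi$ be the set of all $(g_1,\dots,g_d)\in\mathbb C^d$ such that $g_j=\overline{g_i}$ whenever $\alpha_j=\overline{\alpha_i}$ (so that $x_n(g):=\sum_{i=1}^d g_i\alpha_i^n$ is real for all $n$), and let $$\mathcal L(P)=\Bigl\{\limsup_{n\to\infty}\|x_n(g)\| \;:\; g\in\Xi\Bigr\}.$$ For $n\in\mathbb Z$ put $\rho_n=\frac{-1}{2\pi i}\int_{|z|=1+0}\frac{z^{n-1}}{P(z)}\,dz$, the integral being over circles $|z|=r$ with $r>1$ close to $1$. For $m,k\ge 0$ put $$H_d^{(m)}(X_1,\dots,X_d)=\sum_{i_1+\cdots+i_d=m,\ i_j\ge 0}X_1^{i_1}\cdots X_d^{i_d},$$ $$E(X)=\frac{1-(1-X)\prod_{m=0}^{\infty}(1-X^{2^m})}{2X},\qquad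 E^{(k)}(X)=\frac{1+X^{2^k}-(1-X)\prod_{m=0}^{k-1}(1-X^{2^m})}{2X(1+X^{2^k})},$$ $$E_d(X_1,\dots,X_d)=\sum_{i=1}^d\Bigl(\prod_{j\ne i}\frac{X_i}{X_i-X_j}\Bigr)E(X_i),\qquad E_d^{(k)}(X_1,\dots,X_d)=\sum_{i=1}^d\Bigl(\prod_{j\ne i}\frac{X_i}{X_i-X_j}\Bigr)E^{(k)}(X_i).$$ Write $\alpha^{-1}=(\alpha_1^{-1},\dots,\alpha_d^{-1})$. Then the condition $$\text{either }\ \rho_0\ge 2\rho_{-1}\ge 2^2\rho_{-2}\ge\cdots>0\quad\text{or}\quad \rho_0\le 2\rho_{-1}\le 2^2\rho_{-2}\le\cdots<0$$ is equivalent to the condition $$\text{either }\ H_d^{(0)}(\alpha^{-1})\ge 2H_d^{(1)}(\alpha^{-1})\ge 2^2H_d^{(2)}(\alpha^{-1})\ge\cdots>0\quad\text{or}\quad H_d^{(0)}(\alpha^{-1})\le 2H_d^{(1)}(\alpha^{-1})\le 2^2H_d^{(2)}(\alpha^{-1})\le\cdots<0$$ (in each chain all terms are required to be positive, respectively negative).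 If these conditions hold, then $|a_0|^{-1}E_d(\alpha^{-1})$ and all $|a_0|^{-1}E_d^{(k)}(\alpha^{-1})$ are real, $|a_0|^{-1}E_d(\alpha^{-1})$ is the smallest limit point of $\mathcal L(P)$, and $$\mathcal L(P)\cap\Bigl(0,\tfrac1{|a_0|}E_d(\alpha^{-1})\Bigr)=\Bigl\{\tfrac1{|a_0|}E_d^{(k)}(\alpha^{-1}) \;:\; k=0,1,2,\dots\Bigr\}.$$ -/

import Mathlib

open Polynomial

noncomputable section

namespace MarkoffLagrange

/-- The roots of `P` in `ℂ`, with multiplicity. -/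
def complexRoots (P : ℤ[X]) : Multiset ℂ :=
  (P.map (Int.castRingHom ℂ)).roots

/-- `P` is expanding (expansive): all its complex roots have modulus greater than `1`. -/
def IsExpanding (P : ℤ[X]) : Prop :=
  ∀ z ∈ complexRoots P, 1 < ‖z‖

/-- The set of (distinct) roots of `P` of modulus greater than `1`. -/
def expandingRoots (P : ℤ[X]) : Finset ℂ :=
  (complexRoots P).toFinset.filter fun z => 1 < ‖z‖

/-- The parameter space `Ξ`: one constant `g z` for each expanding root `z` of `P`, such that
conjugate roots carry conjugate constants (in particular real roots carry real constants).
The values of `g` off the expanding roots are irrelevant. -/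
def Xi (P : ℤ[X]) : Set (ℂ → ℂ) :=
  {g | ∀ z ∈ expandingRoots P, g (starRingEnd ℂ z) = starRingEnd ℂ (g z)}

/-- `x_n(g) = ∑ g_i α_i ^ n`, the sum over the expanding roots of `P`, as a complex number. -/
def recSeqC (P : ℤ[X]) (g : ℂ → ℂ) (n : ℕ) : ℂ :=
  ∑ z ∈ expandingRoots P, g z * z ^ n

theorem conj_mem_expandingRoots {P : ℤ[X]} {z : ℂ} (hz : z ∈ expandingRoots P) :
    starRingEnd ℂ z ∈ expandingRoots P := by
  simp only [expandingRoots, complexRoots, Finset.mem_filter, Multiset.mem_toFinset,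
    mem_roots', IsRoot.def, eval_map, ne_eq] at hz ⊢
  refine ⟨⟨hz.1.1, ?_⟩, by simpa using hz.2⟩
  have h := congrArg (starRingEnd ℂ) hz.1.2
  rw [hom_eval₂, map_zero] at h
  rwa [Subsingleton.elim ((starRingEnd ℂ).comp (Int.castRingHom ℂ)) (Int.castRingHom ℂ)] at h

/-- For `g ∈ Ξ` the numbers `x_n(g)` are real. -/
theorem recSeqC_conj {P : ℤ[X]} {g : ℂ → ℂ} (hg : g ∈ Xi P) (n : ℕ) :
    starRingEnd ℂ (recSeqC P g n) = recSeqC P g n := by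
  unfold recSeqC
  rw [map_sum]
  refine Finset.sum_nbij' (starRingEnd ℂ) (starRingEnd ℂ)
    (fun z hz => conj_mem_expandingRoots hz) (fun z hz => conj_mem_expandingRoots hz)
    (fun z _ => by simp) (fun z _ => by simp) (fun z hz => ?_)
  rw [map_mul, map_pow, hg z hz]

/-- The real sequence `x_n(g)`; for `g ∈ Ξ` taking the real part changes nothing,
see `recSeqC_conj`. -/
def recSeq (P : ℤ[X]) (g : ℂ → ℂ) (n : ℕ) : ℝ :=
  (recSeqC P g n).re

/-- The distance from `x` to the nearest integer. -/
def distInt (x : ℝ) : ℝ :=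
  |x - round x|

/-- The Markoff-Lagrange spectrum `𝓛(P) = {limsup ‖x_n(g)‖ : g ∈ Ξ}`. -/
def spectrumL (P : ℤ[X]) : Set ℝ :=
  {l | ∃ g ∈ Xi P, l = Filter.limsup (fun n : ℕ => distInt (recSeq P g n)) Filter.atTop}

/-- `ρ_n = -(2πi)⁻¹ ∮ z^(n-1) / P(z) dz` over the circle `|z| = 1 + 0`, that is, over circles
`|z| = r` with `r ↓ 1` (the integral does not depend on `r` for `r > 1` close to `1`). -/
def rho (P : ℤ[X]) (n : ℤ) : ℂ :=
  Filter.limUnder (nhdsWithin (1 : ℝ) (Set.Ioi 1)) fun r : ℝ =>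
    -(2 * Real.pi * Complex.I)⁻¹ * ∮ z in C(0, r), z ^ (n - 1) / aeval z P

/-- The complete homogeneous symmetric sum `H_r^{(m)}(X_1, …, X_r)`. -/
def completeH {r : ℕ} (m : ℕ) (X : Fin r → ℂ) : ℂ :=
  ∑ i ∈ Finset.piAntidiag Finset.univ m, ∏ j, X j ^ (i j : ℕ)

/-- `E(X) = (1 - (1 - X) ∏_{m ≥ 0} (1 - X^(2^m))) / (2X)`. -/
def E (X : ℂ) : ℂ :=
  (1 - (1 - X) * ∏' m : ℕ, (1 - X ^ 2 ^ m)) / (2 * X)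

/-- `E^{(k)}(X) = (1 + X^(2^k) - (1 - X) ∏_{m < k} (1 - X^(2^m))) / (2X (1 + X^(2^k)))`. -/
def Ek (k : ℕ) (X : ℂ) : ℂ :=
  (1 + X ^ 2 ^ k - (1 - X) * ∏ m ∈ Finset.range k, (1 - X ^ 2 ^ m)) /
    (2 * X * (1 + X ^ 2 ^ k))

/-- `∑_i (∏_{j ≠ i} X_i / (X_i - X_j)) F(X_i)`. -/
def symmExt {r : ℕ} (F : ℂ → ℂ) (X : Fin r → ℂ) : ℂ :=
  ∑ i, (∏ j ∈ Finset.univ.erase i, X i / (X i - X j)) * F (X i)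

/-- `E_r(X_1, …, X_r)`. -/
def Er {r : ℕ} (X : Fin r → ℂ) : ℂ :=
  symmExt E X

/-- `E_r^{(k)}(X_1, …, X_r)`. -/
def Erk {r : ℕ} (k : ℕ) (X : Fin r → ℂ) : ℂ :=
  symmExt (Ek k) X

open scoped ComplexOrder in
/-- Either `u 0 ≥ 2 u 1 ≥ 2² u 2 ≥ ⋯ > 0` or `u 0 ≤ 2 u 1 ≤ 2² u 2 ≤ ⋯ < 0`. In the order on `ℂ`
used here, `a ≤ b` means that `b - a` is a non-negative real number (and `a < b` that it is a
positive one), so the terms of such a chain are real. -/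
def HalvingChain (u : ℕ → ℂ) : Prop :=
  (∀ m, 2 ^ (m + 1) * u (m + 1) ≤ 2 ^ m * u m ∧ 0 < 2 ^ m * u m) ∨
    (∀ m, 2 ^ m * u m ≤ 2 ^ (m + 1) * u (m + 1) ∧ 2 ^ m * u m < 0)

end MarkoffLagrange

end

/-! Put `h m = H^{(m)}(α⁻¹)`. All roots lie outside the closed unit disc, so `1 / P(z) = a₀⁻¹ ∑ h m
z^m` there and `ρ_{-m} = -h m / a₀`. The two chains thus differ by a nonzero real factor, and `h 0 =
1` leaves only the positive alternative.

Let `ε n` be `x_n` minus its nearest integer. The recurrence operator turns `ε` into a bounded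
integer sequence `s`, and `ε n = a₀⁻¹ ∑ h m s (n + m)`; conversely every bounded integer `s` for
which these values stay within `1/2` arises (`exists_int_seq`, `exists_mem_Xi`). The halving
condition says that each drop `v m = h m - h (m + 1)` dominates the sum of the later ones. Summation
by parts and this dominance show that, if `|∑ h m s (n + m)| ≤ c < 1` for all `n`, the partial sums
of `s` eventually take only two values (`exists_two_valued`). So `s` comes from a word `τ` in the
letters `±1`, and up to an index shift `‖x_n‖ = (1 - c_n) / (2|a₀|)` with `c_n = τ_n ∑ v m
τ_{n+1+m}`.

It remains to find the large lower limits of `c_n`. The Thue-Morse morphism turns the problem for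
`v` into the one for `renorm v`, up to the additive constant `-v 0`. A word whose correlations stay
above the Thue-Morse value avoids three patterns, hence is constant or a morphic image after
deletion of a prefix. Each desubstitution preserves the gap above the Thue-Morse value but at least
halves the mass, so it must end at a constant word (`exists_isLiminf_of_gap`). Finally `h` is a
combination of geometric sequences, on which renormalization produces the factors `1 - X^(2^m)` of
`E` and `E^{(k)}`. -/

noncomputable section

namespace MarkoffLagrange

open Filter Topology

/-! ### Halving weights and their renormalization -/

/-- Positive summable weights, each of which dominates the sum of all later ones. -/
structure IsHalvingWeight (v : ℕ → ℝ) : Prop where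
  pos : ∀ m, 0 < v m
  summable : Summable v
  tail_le : ∀ m, ∑' j, v (j + (m + 1)) ≤ v m

theorem IsHalvingWeight.summable_tail {v : ℕ → ℝ} (hv : IsHalvingWeight v) (k : ℕ) :
    Summable fun j => v (j + k) :=
  (summable_nat_add_iff k).2 hv.summable

theorem IsHalvingWeight.tail_eq {v : ℕ → ℝ} (hv : IsHalvingWeight v) (k : ℕ) :
    ∑' j, v (j + k) = v k + ∑' j, v (j + (k + 1)) := by
  rw [(hv.summable_tail k).tsum_eq_zero_add, zero_add]
  congr 1
  exact tsum_congr fun j => by rw [add_right_comm, add_assoc]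

theorem IsHalvingWeight.tail_pos {v : ℕ → ℝ} (hv : IsHalvingWeight v) (k : ℕ) :
    0 < ∑' j, v (j + k) :=
  (hv.summable_tail k).tsum_pos (fun _ => (hv.pos _).le) 0 (hv.pos _)

theorem IsHalvingWeight.tsum_pos {v : ℕ → ℝ} (hv : IsHalvingWeight v) : 0 < ∑' j, v j := by
  simpa using hv.tail_pos 0

theorem IsHalvingWeight.tsum_eq {v : ℕ → ℝ} (hv : IsHalvingWeight v) :
    ∑' j, v j = v 0 + ∑' j, v (j + 1) := by
  simpa using hv.tail_eq 0

/-- The weights seen by the preimage of a word under the Thue-Morse morphism. -/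
def renorm (v : ℕ → ℝ) (j : ℕ) : ℝ := v (2 * j + 1) - v (2 * j + 2)

theorem IsHalvingWeight.renorm_le {v : ℕ → ℝ} (hv : IsHalvingWeight v) (j : ℕ) :
    renorm v j ≤ v (2 * j + 1) := by
  have := hv.pos (2 * j + 2)
  unfold renorm
  linarith

theorem IsHalvingWeight.add_tail_le {v : ℕ → ℝ} (hv : IsHalvingWeight v) (m : ℕ) :
    v (m + 1) + ∑' j, v (j + (m + 2)) ≤ v m := by
  have := hv.tail_le m
  rwa [hv.tail_eq (m + 1)] at this

theorem IsHalvingWeight.summable_comp {v : ℕ → ℝ} (hv : IsHalvingWeight v) (k : ℕ) :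
    Summable fun j => v (2 * j + k) :=
  hv.summable.comp_injective fun a b h => by
    simpa using h

theorem IsHalvingWeight.summable_renorm {v : ℕ → ℝ} (hv : IsHalvingWeight v) :
    Summable (renorm v) :=
  (hv.summable_comp 1).sub (hv.summable_comp 2)

/-- The new weight at `m` is at least the tail of `v` from `2m + 3`, while the later new weights are
bounded by a subfamily of that tail, the odd-indexed terms. -/
theorem IsHalvingWeight.renorm {v : ℕ → ℝ} (hv : IsHalvingWeight v) :
    IsHalvingWeight (renorm v) where
  pos j := by
    have h1 := hv.add_tail_le (2 * j + 1)
    have h2 := hv.tail_pos (2 * j + 1 + 2)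
    have : v (2 * j + 1 + 1) = v (2 * j + 2) := rfl
    unfold MarkoffLagrange.renorm
    linarith
  summable := hv.summable_renorm
  tail_le m := by
    have h1 := hv.add_tail_le (2 * m + 1)
    have h2 : ∑' j, MarkoffLagrange.renorm v (j + (m + 1)) ≤ ∑' j, v (2 * j + (2 * m + 1 + 2)) := by
      refine Summable.tsum_le_tsum (fun j => ?_)
        ((summable_nat_add_iff (m + 1)).2 hv.summable_renorm) (hv.summable_comp _)
      refine (hv.renorm_le _).trans_eq ?_
      congr 1
      ring
    have h3 : ∑' j, v (2 * j + (2 * m + 1 + 2)) ≤ ∑' j, v (j + (2 * m + 1 + 2)) :=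
      Summable.tsum_le_tsum_of_inj (fun j => 2 * j) (fun a b h => by simpa using h)
        (fun _ _ => (hv.pos _).le) (fun j => le_rfl) (hv.summable_comp _) (hv.summable_tail _)
    have : v (2 * m + 1 + 1) = v (2 * m + 2) := rfl
    unfold MarkoffLagrange.renorm at *
    linarith

theorem IsHalvingWeight.tsum_renorm_le {v : ℕ → ℝ} (hv : IsHalvingWeight v) :
    ∑' j, MarkoffLagrange.renorm v j ≤ v 1 := by
  have h1 := hv.renorm.tsum_eq
  have h2 := hv.tail_le 2
  have h3 : ∑' j, MarkoffLagrange.renorm v (j + 1) ≤ ∑' j, v (j + (2 + 1)) := by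
    refine (Summable.tsum_le_tsum (fun j => ?_)
      ((summable_nat_add_iff 1).2 hv.summable_renorm) (hv.summable_comp 3)).trans
      (Summable.tsum_le_tsum_of_inj (fun j => 2 * j) (fun a b h => by simpa using h)
      (fun _ _ => (hv.pos _).le) (fun j => le_rfl) (hv.summable_comp _) (hv.summable_tail _))
    exact hv.renorm_le _
  have : MarkoffLagrange.renorm v 0 = v 1 - v 2 := rfl
  linarith

/-- The new mass is at most `v 1`, and `2 * v 1 ≤ v 0 + v 1`. This contraction drives both the
convergence of `lamFin` and the termination of desubstitution. -/
theorem IsHalvingWeight.two_mul_tsum_renorm_le {v : ℕ → ℝ} (hv : IsHalvingWeight v) :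
    2 * ∑' j, MarkoffLagrange.renorm v j ≤ ∑' j, v j := by
  have h1 := hv.tsum_renorm_le
  have h2 := hv.tsum_eq
  have h3 := hv.tail_le 0
  have h4 := hv.tail_eq 1
  have h5 := hv.tail_pos 2
  norm_num at *
  linarith

theorem IsHalvingWeight.iterate_renorm {v : ℕ → ℝ} (hv : IsHalvingWeight v) (k : ℕ) :
    IsHalvingWeight (MarkoffLagrange.renorm^[k] v) := by
  induction k with
  | zero => exact hv
  | succ k ih => rw [Function.iterate_succ_apply']; exact ih.renorm

theorem IsHalvingWeight.sum_iterate_le {v : ℕ → ℝ} (hv : IsHalvingWeight v) (k : ℕ) :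
    ∑ i ∈ Finset.range k, (MarkoffLagrange.renorm^[i] v) 0 ≤ ∑' j, v j := by
  induction k generalizing v with
  | zero => simpa using hv.tsum_pos.le
  | succ k ih =>
    rw [Finset.sum_range_succ']
    simp only [Function.iterate_succ_apply, Function.iterate_zero, id]
    have h1 := ih hv.renorm
    have h2 := hv.tsum_renorm_le
    have h3 := hv.tsum_eq
    have h4 := hv.tail_eq 1
    have h5 := hv.tail_pos 2
    norm_num at *
    linarith

theorem IsHalvingWeight.summable_iterate {v : ℕ → ℝ} (hv : IsHalvingWeight v) :
    Summable fun i => (MarkoffLagrange.renorm^[i] v) 0 :=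
  summable_of_sum_range_le (fun i => ((hv.iterate_renorm i).pos 0).le) hv.sum_iterate_le

/-! ### Extremal correlation values -/

/-- The correlation of the constant word after `k` applications of the Thue-Morse morphism. -/
def lamFin (v : ℕ → ℝ) : ℕ → ℝ
  | 0 => ∑' j, v j
  | k + 1 => -v 0 + lamFin (renorm v) k

/-- The correlation of the Thue-Morse word. -/
def lamInf (v : ℕ → ℝ) : ℝ := -∑' i, (renorm^[i] v) 0

theorem lamFin_eq (v : ℕ → ℝ) (k : ℕ) :
    lamFin v k =
      -∑ i ∈ Finset.range k, (renorm^[i] v) 0 + ∑' j, (renorm^[k] v) j := by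
  induction k generalizing v with
  | zero => simp [lamFin]
  | succ k ih =>
    rw [lamFin, ih, Finset.sum_range_succ']
    simp only [Function.iterate_succ_apply, Function.iterate_zero, id]
    ring

theorem IsHalvingWeight.lamInf_eq {v : ℕ → ℝ} (hv : IsHalvingWeight v) :
    lamInf v = -v 0 + lamInf (MarkoffLagrange.renorm v) := by
  rw [lamInf, hv.summable_iterate.tsum_eq_zero_add, lamInf]
  simp only [Function.iterate_succ_apply, Function.iterate_zero, id]
  ring

theorem IsHalvingWeight.neg_tsum_le_lamInf {v : ℕ → ℝ} (hv : IsHalvingWeight v) :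
    -∑' j, v j ≤ lamInf v :=
  neg_le_neg (hv.summable_iterate.tsum_le_of_sum_range_le hv.sum_iterate_le)

theorem IsHalvingWeight.lamInf_neg {v : ℕ → ℝ} (hv : IsHalvingWeight v) : lamInf v < 0 :=
  neg_neg_of_pos (hv.summable_iterate.tsum_pos (fun i => ((hv.iterate_renorm i).pos 0).le) 0
    (hv.pos 0))

theorem IsHalvingWeight.lamInf_lt_lamFin {v : ℕ → ℝ} (hv : IsHalvingWeight v) (k : ℕ) :
    lamInf v < lamFin v k := by
  induction k generalizing v with
  | zero => exact hv.lamInf_neg.trans hv.tsum_pos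
  | succ k ih =>
    rw [hv.lamInf_eq, lamFin]
    linarith [ih hv.renorm]

/-- The terms `-v 0` cancel, so the difference is passed unchanged to `renorm v`, whose mass is at
most half. -/
theorem IsHalvingWeight.lamFin_sub_lamInf_le {v : ℕ → ℝ} (hv : IsHalvingWeight v) (k : ℕ) :
    2 ^ k * (lamFin v k - lamInf v) ≤ 2 * ∑' j, v j := by
  induction k generalizing v with
  | zero => simp only [lamFin]; linarith [hv.neg_tsum_le_lamInf]
  | succ k ih =>
    rw [hv.lamInf_eq, lamFin, pow_succ]
    linarith [ih hv.renorm, hv.two_mul_tsum_renorm_le]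

theorem IsHalvingWeight.tendsto_lamFin {v : ℕ → ℝ} (hv : IsHalvingWeight v) :
    Tendsto (lamFin v) atTop (𝓝 (lamInf v)) := by
  have h : Tendsto (fun k : ℕ => lamInf v + (2 * ∑' j, v j) * (1 / 2 : ℝ) ^ k) atTop
      (𝓝 (lamInf v + (2 * ∑' j, v j) * 0)) :=
    tendsto_const_nhds.add
      ((tendsto_pow_atTop_nhds_zero_of_lt_one (by norm_num) (by norm_num)).const_mul _)
  rw [mul_zero, add_zero] at h
  refine tendsto_of_tendsto_of_tendsto_of_le_of_le tendsto_const_nhds h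
    (fun k => (hv.lamInf_lt_lamFin k).le) fun k => ?_
  have h1 := hv.lamFin_sub_lamInf_le k
  have h2 : (0 : ℝ) < 2 ^ k := by positivity
  have h3 : lamFin v k - lamInf v ≤ (2 * ∑' j, v j) / 2 ^ k := by
    rw [le_div_iff₀ h2]; linarith
  simp only [one_div, inv_pow]
  rw [div_eq_mul_inv] at h3
  linarith

theorem IsHalvingWeight.lamFin_strictAnti {v : ℕ → ℝ} (hv : IsHalvingWeight v) :
    StrictAnti (lamFin v) := by
  refine strictAnti_nat_of_succ_lt fun k => ?_
  induction k generalizing v with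
  | zero =>
    simp only [lamFin]
    linarith [hv.two_mul_tsum_renorm_le, hv.renorm.tsum_pos, hv.pos 0]
  | succ k ih =>
    have := ih hv.renorm
    simp only [lamFin] at this ⊢
    linarith

/-- Three renormalizations give `-v 0 - v 1 + v 2 - v 3 + v 4 + v 5 - v 6` and a remainder of at
least `-v 7`; dominance gives `v 6 + v 7 ≤ v 5`. The bound is exactly what the longest forbidden
word needs. -/
theorem IsHalvingWeight.le_lamInf {v : ℕ → ℝ} (hv : IsHalvingWeight v) :
    -v 0 - v 1 + v 2 - v 3 + v 4 ≤ lamInf v := by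
  have h1 := hv.lamInf_eq
  have h2 := hv.renorm.lamInf_eq
  have h3 := hv.renorm.renorm.lamInf_eq
  have h4 := hv.renorm.renorm.renorm.neg_tsum_le_lamInf
  have h5 := hv.renorm.renorm.tsum_renorm_le
  have h6 := hv.renorm.renorm_le 3
  have h7 := hv.renorm_le 3
  have h8 := hv.tail_le 5
  have h9 := hv.tail_eq 6
  have h10 := hv.tail_eq 7
  have h11 := hv.tail_pos 8
  have h12 := hv.renorm.renorm_le 1
  simp only [MarkoffLagrange.renorm] at *
  norm_num at *
  linarith

/-! ### Correlations of words and the Thue-Morse morphism -/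

/-- The sign `±1` of a letter. -/
def sgn (b : Bool) : ℝ := if b then 1 else -1

@[simp] theorem sgn_true : sgn true = 1 := rfl

@[simp] theorem sgn_false : sgn false = -1 := rfl

theorem sgn_not (b : Bool) : sgn (!b) = -sgn b := by cases b <;> simp

theorem sgn_mul_self (b : Bool) : sgn b * sgn b = 1 := by cases b <;> simp

theorem abs_sgn (b : Bool) : |sgn b| = 1 := by cases b <;> simp

/-- The correlation of the letter at `n` with the later letters. -/
def corr (v : ℕ → ℝ) (τ : ℕ → Bool) (n : ℕ) : ℝ :=
  sgn (τ n) * ∑' m, v m * sgn (τ (n + 1 + m))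

theorem corr_shift (v : ℕ → ℝ) (τ : ℕ → Bool) (N n : ℕ) :
    corr v (fun i => τ (i + N)) n = corr v τ (n + N) := by
  unfold corr
  congr 1
  exact tsum_congr fun m => by simp only [show n + 1 + m + N = n + N + 1 + m by ring]

theorem summable_mul_sgn {v : ℕ → ℝ} (h0 : ∀ m, 0 ≤ v m) (hv : Summable v) (τ : ℕ → Bool) :
    Summable fun m => v m * sgn (τ m) :=
  Summable.of_norm_bounded hv fun m => by
    rw [Real.norm_eq_abs, abs_mul, abs_sgn, mul_one, abs_of_nonneg (h0 m)]

theorem sgn_mul_tsum_le {v : ℕ → ℝ} (h0 : ∀ m, 0 ≤ v m) (hv : Summable v) (b : Bool)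
    (τ : ℕ → Bool) : sgn b * ∑' m, v m * sgn (τ m) ≤ ∑' m, v m := by
  rw [← tsum_mul_left]
  refine Summable.tsum_le_tsum (fun m => ?_) ((summable_mul_sgn h0 hv τ).mul_left _) hv
  cases b <;> cases τ m <;> simp <;> linarith [h0 m]

theorem IsHalvingWeight.corr_le_tsum {v : ℕ → ℝ} (hv : IsHalvingWeight v) (τ : ℕ → Bool) (n : ℕ) :
    corr v τ n ≤ ∑' m, v m :=
  sgn_mul_tsum_le (fun m => (hv.pos m).le) hv.summable _ _

/-- The letters after the first `k + 1` terms are unknown, but their total weight is at most `v k`.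
-/
theorem IsHalvingWeight.corr_le {v : ℕ → ℝ} (hv : IsHalvingWeight v) (τ : ℕ → Bool) (n k : ℕ) :
    corr v τ n ≤ sgn (τ n) * ∑ m ∈ Finset.range (k + 1), v m * sgn (τ (n + 1 + m)) + v k := by
  have h := summable_mul_sgn (fun m => (hv.pos m).le) hv.summable fun m => τ (n + 1 + m)
  rw [corr, ← h.sum_add_tsum_nat_add (k + 1), mul_add]
  have := sgn_mul_tsum_le (v := fun m => v (m + (k + 1))) (fun m => (hv.pos _).le)
    (hv.summable_tail _) (τ n) fun m => τ (n + 1 + (m + (k + 1)))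
  linarith [hv.tail_le k]

/-- The Thue-Morse morphism on infinite words. -/
def morph (τ : ℕ → Bool) (n : ℕ) : Bool := xor (τ (n / 2)) (decide (n % 2 = 1))

@[simp] theorem morph_even (τ : ℕ → Bool) (k : ℕ) : morph τ (2 * k) = τ k := by
  simp [morph]

@[simp] theorem morph_odd (τ : ℕ → Bool) (k : ℕ) : morph τ (2 * k + 1) = !τ k := by
  have h : (2 * k + 1) / 2 = k := by omega
  simp [morph, h]

theorem tsum_eq_tsum_even_add_odd {f : ℕ → ℝ} (hf : Summable f) :
    ∑' j, f j = ∑' j, (f (2 * j) + f (2 * j + 1)) := by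
  have he : Summable fun j => f (2 * j) :=
    hf.comp_injective fun a b h => by simpa using h
  have ho : Summable fun j => f (2 * j + 1) :=
    hf.comp_injective (i := fun j => 2 * j + 1) fun a b h => by simpa using h
  rw [he.tsum_add ho, tsum_even_add_odd he ho]

/-- The partner letter contributes `-v 0`; every later pair consists of a letter and its negation,
with net weight `v (2j+1) - v (2j+2)`. -/
theorem corr_morph_even {v : ℕ → ℝ} (hv : IsHalvingWeight v) (τ : ℕ → Bool) (k : ℕ) :
    corr v (morph τ) (2 * k) = -v 0 + corr (renorm v) τ k := by
  have h := summable_mul_sgn (fun m => (hv.pos m).le) hv.summable fun m => morph τ (2 * k + 1 + m)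
  have h1 : ∀ j, v (2 * j + 1) * sgn (morph τ (2 * k + 1 + (2 * j + 1))) +
      v (2 * j + 1 + 1) * sgn (morph τ (2 * k + 1 + (2 * j + 1 + 1))) =
      renorm v j * sgn (τ (k + 1 + j)) := fun j => by
    rw [show 2 * k + 1 + (2 * j + 1 + 1) = 2 * (k + 1 + j) + 1 by ring,
      show 2 * k + 1 + (2 * j + 1) = 2 * (k + 1 + j) by ring, morph_even, morph_odd, sgn_not, renorm]
    ring
  have h2 := tsum_eq_tsum_even_add_odd ((summable_nat_add_iff 1).2 h)
  simp only [h1] at h2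
  rw [corr, h.tsum_eq_zero_add, h2, corr, add_zero, morph_even, morph_odd, sgn_not]
  linear_combination (-v 0) * sgn_mul_self (τ k)

/-- Seen from the second letter of a pair, later pairs have net weights `v (2j) - v (2j+1)`, of
total `v 0 - ∑ renorm v`. The resulting bound is at least the value at every even position, so odd
positions do not affect the lower limit. -/
theorem le_corr_morph_odd {v : ℕ → ℝ} (hv : IsHalvingWeight v) (τ : ℕ → Bool) (k : ℕ) :
    -v 0 + ∑' j, renorm v j ≤ corr v (morph τ) (2 * k + 1) := by
  have h := summable_mul_sgn (fun m => (hv.pos m).le) hv.summable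
    fun m => morph τ (2 * k + 1 + 1 + m)
  have h1 : ∀ j, v (2 * j) * sgn (morph τ (2 * k + 1 + 1 + 2 * j)) +
      v (2 * j + 1) * sgn (morph τ (2 * k + 1 + 1 + (2 * j + 1))) =
      (v (2 * j) - v (2 * j + 1)) * sgn (τ (k + 1 + j)) := fun j => by
    rw [show 2 * k + 1 + 1 + (2 * j + 1) = 2 * (k + 1 + j) + 1 by ring,
      show 2 * k + 1 + 1 + 2 * j = 2 * (k + 1 + j) by ring, morph_even, morph_odd, sgn_not]
    ring
  have h0 : ∀ j, 0 ≤ v (2 * j) - v (2 * j + 1) := fun j => by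
    have h1 := hv.add_tail_le (2 * j)
    have h2 := hv.tail_pos (2 * j + 2)
    linarith
  have hs : Summable fun j => v (2 * j) - v (2 * j + 1) :=
    (hv.summable_comp 0).sub (hv.summable_comp 1)
  have h2 : ∑' j, (v (2 * j) - v (2 * j + 1)) = v 0 - ∑' j, renorm v j := by
    have e0 : ∑' j, v (2 * j) = v 0 + ∑' j, v (2 * j + 2) := (hv.summable_comp 0).tsum_eq_zero_add
    have e1 : ∑' j, (v (2 * j) - v (2 * j + 1)) = ∑' j, v (2 * j) - ∑' j, v (2 * j + 1) :=
      (hv.summable_comp 0).tsum_sub (hv.summable_comp 1)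
    have e2 : ∑' j, renorm v j = ∑' j, v (2 * j + 1) - ∑' j, v (2 * j + 2) :=
      (hv.summable_comp 1).tsum_sub (hv.summable_comp 2)
    linarith
  have h4 := tsum_eq_tsum_even_add_odd h
  simp only [h1] at h4
  rw [corr, h4, morph_odd, sgn_not]
  have h3 := sgn_mul_tsum_le h0 hs (τ k) fun j => τ (k + 1 + j)
  linarith

/-! ### Lower limits of correlations -/

/-- `l` is the lower limit of the real sequence `u`. -/
def IsLiminf (u : ℕ → ℝ) (l : ℝ) : Prop :=
  (∀ a < l, ∀ᶠ n in atTop, a < u n) ∧ ∀ b > l, ∃ᶠ n in atTop, u n < b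

theorem IsLiminf.of_shift {u : ℕ → ℝ} {l : ℝ} (N : ℕ) (h : IsLiminf (fun n => u (n + N)) l) :
    IsLiminf u l := by
  refine ⟨fun a ha => ?_, fun b hb => ?_⟩
  · obtain ⟨M, hM⟩ := eventually_atTop.1 (h.1 a ha)
    refine eventually_atTop.2 ⟨M + N, fun n hn => ?_⟩
    have : a < u (n - N + N) := hM (n - N) (by omega)
    rwa [Nat.sub_add_cancel (by omega)] at this
  · rw [frequently_atTop]
    intro M
    obtain ⟨n, hn, hn'⟩ := frequently_atTop.1 (h.2 b hb) M
    exact ⟨n + N, by omega, hn'⟩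

theorem IsLiminf.morph {v : ℕ → ℝ} (hv : IsHalvingWeight v) {τ : ℕ → Bool} {l : ℝ}
    (h : IsLiminf (corr (renorm v) τ) l) :
    IsLiminf (corr v (morph τ)) (-v 0 + l) := by
  refine ⟨fun a ha => ?_, fun b hb => ?_⟩
  · obtain ⟨M, hM⟩ := eventually_atTop.1 (h.1 (a + v 0) (by linarith))
    refine eventually_atTop.2 ⟨2 * M, fun n hn => ?_⟩
    have h1 := hM (n / 2) (by omega)
    rcases Nat.even_or_odd' n with ⟨k, rfl | rfl⟩
    · rw [corr_morph_even hv]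
      rw [show 2 * k / 2 = k by omega] at h1
      linarith
    · have := le_corr_morph_odd hv τ k
      have := hv.renorm.corr_le_tsum τ ((2 * k + 1) / 2)
      linarith
  · rw [frequently_atTop]
    intro M
    obtain ⟨n, hn, hn'⟩ := frequently_atTop.1 (h.2 (b + v 0) (by linarith)) M
    refine ⟨2 * n, by omega, ?_⟩
    rw [corr_morph_even hv]
    linarith

theorem isLiminf_const {v : ℕ → ℝ} {τ : ℕ → Bool} {c : Bool}
    (h : ∀ n, τ n = c) : IsLiminf (corr v τ) (∑' j, v j) := by
  have : ∀ n, corr v τ n = ∑' j, v j := fun n => by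
    simp only [corr, h, tsum_mul_right]
    linear_combination (∑' j, v j) * sgn_mul_self c
  refine ⟨fun a ha => Eventually.of_forall fun n => ?_, fun b hb =>
    (Eventually.of_forall fun n => ?_).frequently⟩ <;> rw [this]
  exacts [ha, hb]

theorem isLiminf_iterate_morph {v : ℕ → ℝ} (hv : IsHalvingWeight v) (k : ℕ) :
    IsLiminf (corr v (morph^[k] fun _ => true)) (lamFin v k) := by
  induction k generalizing v with
  | zero => exact isLiminf_const (c := true) fun _ => rfl
  | succ k ih =>
    rw [Function.iterate_succ_apply', lamFin]
    exact (ih hv.renorm).morph hv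

/-! ### Forbidden words and desubstitution -/

/-- The words forbidden by a correlation above `lamInf v`. -/
theorem corr_le_lamInf {v : ℕ → ℝ} (hv : IsHalvingWeight v) (τ : ℕ → Bool) (n : ℕ)
    (h : (τ (n + 1) ≠ τ n ∧ τ (n + 2) ≠ τ n ∧ τ (n + 3) ≠ τ n) ∨
      (τ (n + 1) ≠ τ n ∧ τ (n + 2) ≠ τ n ∧ τ (n + 3) = τ n ∧ τ (n + 4) ≠ τ n ∧
        τ (n + 5) ≠ τ n) ∨
      (τ (n + 1) ≠ τ n ∧ τ (n + 2) ≠ τ n ∧ τ (n + 3) = τ n ∧ τ (n + 4) ≠ τ n ∧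
        τ (n + 5) = τ n ∧ τ (n + 6) ≠ τ n)) :
    corr v τ n ≤ lamInf v := by
  have h0 := hv.le_lamInf
  have h4 := hv.pos 4
  have h3 := hv.add_tail_le 2
  have h3' := hv.tail_pos 4
  have key : ∀ m, τ m ≠ τ n → sgn (τ m) = -sgn (τ n) := fun m hm => by
    rw [← sgn_not]
    congr 1
    cases h1 : τ m <;> cases h2 : τ n <;> simp_all
  have hs := sgn_mul_self (τ n)
  -- In each case the last prescribed letter contributes minus its weight, which cancels the
  -- allowance for the tail. What remains is `-v 0 - v 1`, then `-v 0 - v 1 + v 2 - v 3`, then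
  -- exactly the bound in `h0`.
  rcases h with ⟨h1, h2, h5⟩ | ⟨h1, h2, h5, h6, h7⟩ | ⟨h1, h2, h5, h6, h7, h8⟩
  · have := hv.corr_le τ n 2
    simp only [Finset.sum_range_succ, Finset.sum_range_zero, add_zero, zero_add,
      add_assoc, Nat.reduceAdd] at this
    rw [key _ h1, key _ h2, key _ h5] at this
    have e : sgn (τ n) * (v 0 * -sgn (τ n) + (v 1 * -sgn (τ n) + v 2 * -sgn (τ n))) =
        -v 0 - v 1 - v 2 := by linear_combination (-v 0 - v 1 - v 2) * hs
    norm_num at *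
    linarith
  · have := hv.corr_le τ n 4
    simp only [Finset.sum_range_succ, Finset.sum_range_zero, add_zero, zero_add,
      add_assoc, Nat.reduceAdd] at this
    rw [key _ h1, key _ h2, h5, key _ h6, key _ h7] at this
    have e : sgn (τ n) * (v 0 * -sgn (τ n) + (v 1 * -sgn (τ n) + (v 2 * sgn (τ n) +
        (v 3 * -sgn (τ n) + v 4 * -sgn (τ n))))) =
        -v 0 - v 1 + v 2 - v 3 - v 4 := by
      linear_combination (-v 0 - v 1 + v 2 - v 3 - v 4) * hs
    linarith
  · have := hv.corr_le τ n 5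
    simp only [Finset.sum_range_succ, Finset.sum_range_zero, add_zero, zero_add,
      add_assoc, Nat.reduceAdd] at this
    rw [key _ h1, key _ h2, h5, key _ h6, h7, key _ h8] at this
    have e : sgn (τ n) * (v 0 * -sgn (τ n) + (v 1 * -sgn (τ n) + (v 2 * sgn (τ n) +
        (v 3 * -sgn (τ n) + (v 4 * sgn (τ n) + v 5 * -sgn (τ n)))))) =
        -v 0 - v 1 + v 2 - v 3 + v 4 - v 5 := by
      linear_combination (-v 0 - v 1 + v 2 - v 3 + v 4 - v 5) * hs
    linarith

/-- Write `x y y` for the letters from `p` on. As `xyyy` is forbidden, `x` follows. Either the word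
goes on `xyyxx`, or `xyyxy`, and then the other two patterns force `xyyxyxx`. So a new double
letter, preceded by a change, occurs two or four places later, and the pairs cut through the middle
of the doubles are unequal in between. -/
theorem pairs_ne_of_double (τ : ℕ → Bool)
    (hf : ∀ n, ¬((τ (n + 1) ≠ τ n ∧ τ (n + 2) ≠ τ n ∧ τ (n + 3) ≠ τ n) ∨
      (τ (n + 1) ≠ τ n ∧ τ (n + 2) ≠ τ n ∧ τ (n + 3) = τ n ∧ τ (n + 4) ≠ τ n ∧
        τ (n + 5) ≠ τ n) ∨
      (τ (n + 1) ≠ τ n ∧ τ (n + 2) ≠ τ n ∧ τ (n + 3) = τ n ∧ τ (n + 4) ≠ τ n ∧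
        τ (n + 5) = τ n ∧ τ (n + 6) ≠ τ n)))
    (k p : ℕ) (h1 : τ (p + 1) ≠ τ p) (h2 : τ (p + 2) = τ (p + 1)) :
    τ (p + 2 + 2 * k + 1) ≠ τ (p + 2 + 2 * k) := by
  induction k using Nat.strong_induction_on generalizing p with
  | _ k ih =>
  have hp := hf p
  have hp2 := hf (p + 2)
  simp only [add_assoc, Nat.reduceAdd] at hp hp2
  have key : τ (p + 3) ≠ τ (p + 2) ∧ ((τ (p + 4) = τ (p + 3)) ∨
      (τ (p + 5) ≠ τ (p + 4) ∧ τ (p + 6) = τ (p + 5))) := by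
    generalize τ p = a0 at *
    generalize τ (p + 1) = a1 at *
    generalize τ (p + 2) = a2 at *
    generalize τ (p + 3) = a3 at *
    generalize τ (p + 4) = a4 at *
    generalize τ (p + 5) = a5 at *
    generalize τ (p + 6) = a6 at *
    clear ih hf
    revert a0 a1 a2 a3 a4 a5 a6
    grind
  obtain ⟨h3, h4 | ⟨h5, h6⟩⟩ := key
  · rcases k with _ | k
    · simpa using h3
    · have := ih k (by omega) (p + 2) h3 h4
      rwa [show p + 2 + 2 * (k + 1) = p + 2 + 2 + 2 * k by ring]
  · rcases k with _ | _ | k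
    · simpa using h3
    · simpa [add_assoc] using h5
    · have := ih k (by omega) (p + 4) h5 h6
      rwa [show p + 2 + 2 * (k + 1 + 1) = p + 4 + 2 + 2 * k by ring]

/-- If a double letter follows some change, it fixes where to cut into pairs. Otherwise the word
alternates from its first change on, and any cut there works. -/
theorem exists_desubstitution (τ : ℕ → Bool)
    (hf : ∀ n, ¬((τ (n + 1) ≠ τ n ∧ τ (n + 2) ≠ τ n ∧ τ (n + 3) ≠ τ n) ∨
      (τ (n + 1) ≠ τ n ∧ τ (n + 2) ≠ τ n ∧ τ (n + 3) = τ n ∧ τ (n + 4) ≠ τ n ∧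
        τ (n + 5) ≠ τ n) ∨
      (τ (n + 1) ≠ τ n ∧ τ (n + 2) ≠ τ n ∧ τ (n + 3) = τ n ∧ τ (n + 4) ≠ τ n ∧
        τ (n + 5) = τ n ∧ τ (n + 6) ≠ τ n)))
    (hne : ∃ p, τ (p + 1) ≠ τ p) :
    ∃ N, (fun n => τ (n + N)) = morph fun k => τ (2 * k + N) := by
  have h : ∃ N, ∀ k, τ (N + 2 * k + 1) ≠ τ (N + 2 * k) := by
    by_cases hd : ∃ p, τ (p + 1) ≠ τ p ∧ τ (p + 2) = τ (p + 1)
    · obtain ⟨p, hp1, hp2⟩ := hd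
      exact ⟨p + 2, fun k => pairs_ne_of_double τ hf k p hp1 hp2⟩
    · push Not at hd
      obtain ⟨p, hp⟩ := hne
      have : ∀ k, τ (p + k + 1) ≠ τ (p + k) := fun k => by
        induction k with
        | zero => exact hp
        | succ k ih => exact hd _ ih
      exact ⟨p, fun k => this (2 * k)⟩
  obtain ⟨N, hN⟩ := h
  refine ⟨N, funext fun n => ?_⟩
  rcases Nat.even_or_odd' n with ⟨k, rfl | rfl⟩
  · rw [morph_even]
  · rw [morph_odd]
    have := hN k
    rw [add_comm N, add_right_comm] at this
    cases h1 : τ (2 * k + 1 + N) <;> cases h2 : τ (2 * k + N) <;> simp_all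

/-- `K` bounds the number of desubstitutions. All correlations and `lamInf v` lie within the mass of
`0`, so a gap cannot exceed twice the mass; desubstitution keeps the gap and at least halves the
mass. -/
theorem exists_isLiminf_of_gap (K : ℕ) {v : ℕ → ℝ} (hv : IsHalvingWeight v) {g : ℝ}
    (τ : ℕ → Bool) (hg : 2 * ∑' j, v j < 2 ^ K * g)
    (hτ : ∀ᶠ n in atTop, lamInf v + g ≤ corr v τ n) :
    ∃ k, IsLiminf (corr v τ) (lamFin v k) := by
  induction K generalizing v τ with
  | zero =>
    obtain ⟨n, hn⟩ := hτ.exists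
    linarith [hv.neg_tsum_le_lamInf, hv.corr_le_tsum τ n]
  | succ K ih =>
    have hg0 : 0 < g := by
      by_contra h
      have h1 : (2 : ℝ) ^ (K + 1) * g ≤ 0 :=
        mul_nonpos_of_nonneg_of_nonpos (by positivity) (not_lt.1 h)
      linarith [hv.tsum_pos]
    obtain ⟨M, hM⟩ := eventually_atTop.1 hτ
    set τ₁ : ℕ → Bool := fun n => τ (n + M) with hτ₁
    have hM₁ : ∀ n, lamInf v + g ≤ corr v τ₁ n := fun n => by
      rw [hτ₁, corr_shift]
      exact hM _ (by omega)
    have hsh : ∀ k, IsLiminf (corr v τ₁) (lamFin v k) → IsLiminf (corr v τ) (lamFin v k) :=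
      fun k h => IsLiminf.of_shift M (by
        rw [hτ₁] at h
        simpa only [← corr_shift] using h)
    by_cases hne : ∃ p, τ₁ (p + 1) ≠ τ₁ p
    · obtain ⟨N, hN⟩ := exists_desubstitution τ₁ (fun n hn => by
        linarith [corr_le_lamInf hv τ₁ n hn, hM₁ n]) hne
      have h1 : ∀ n, lamInf (renorm v) + g ≤ corr (renorm v) (fun k => τ₁ (2 * k + N)) n := by
        intro n
        have h2 := hM₁ (2 * n + N)
        rw [← corr_shift, hN, corr_morph_even hv, hv.lamInf_eq] at h2
        linarith
      obtain ⟨k, hk⟩ := ih hv.renorm (fun k => τ₁ (2 * k + N))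
        (by rw [pow_succ] at hg; linarith [hv.two_mul_tsum_renorm_le]) (Eventually.of_forall h1)
      refine ⟨k + 1, hsh _ (IsLiminf.of_shift N ?_)⟩
      have h2 := hk.morph hv
      rw [← hN] at h2
      exact (funext fun n => corr_shift v τ₁ N n) ▸ h2
    · push Not at hne
      refine ⟨0, hsh _ (isLiminf_const (c := τ₁ 0) fun n => ?_)⟩
      induction n with
      | zero => rfl
      | succ n ih' => rw [hne, ih']

/-- Above the correlation of the Thue-Morse word, the lower limits of correlations are those of
the words obtained from a constant word by iterating the Thue-Morse morphism. -/
theorem exists_isLiminf_lamFin {v : ℕ → ℝ} (hv : IsHalvingWeight v) {a : ℝ}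
    (ha : lamInf v < a) (τ : ℕ → Bool) (hτ : ∀ᶠ n in atTop, a ≤ corr v τ n) :
    ∃ k, IsLiminf (corr v τ) (lamFin v k) := by
  obtain ⟨K, hK⟩ := pow_unbounded_of_one_lt (2 * (∑' j, v j) / (a - lamInf v)) one_lt_two
  rw [div_lt_iff₀ (sub_pos.2 ha)] at hK
  exact exists_isLiminf_of_gap K hv τ hK (by simpa using hτ)

/-! ### Halving sequences and summation by parts -/

/-- Positive real sequences starting at `1` that at least halve in each step. -/
structure IsHalving (h : ℕ → ℝ) : Prop where
  pos : ∀ m, 0 < h m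
  zero : h 0 = 1
  two_mul_le : ∀ m, 2 * h (m + 1) ≤ h m

/-- The consecutive differences of a decreasing sequence. -/
def drops (h : ℕ → ℝ) (m : ℕ) : ℝ := h m - h (m + 1)

namespace IsHalving

variable {h : ℕ → ℝ}

theorem le_pow (hh : IsHalving h) (m : ℕ) : h m ≤ (1 / 2) ^ m := by
  induction m with
  | zero => simp [hh.zero]
  | succ m ih =>
    have := hh.two_mul_le m
    rw [pow_succ]
    linarith

/-- Linear growth is allowed because `D` will be a difference of partial sums of a bounded sequence.
-/
theorem summable_mul_of_linear (hh : IsHalving h) {D : ℕ → ℝ} {A B : ℝ}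
    (hD : ∀ m, |D m| ≤ A + B * m) : Summable fun m => h m * D m := by
  have h1 : Summable fun m : ℕ => A * (1 / 2 : ℝ) ^ m + B * ((m : ℝ) ^ 1 * (1 / 2 : ℝ) ^ m) :=
    ((summable_geometric_of_lt_one (by norm_num) (by norm_num)).mul_left A).add
      ((summable_pow_mul_geometric_of_norm_lt_one 1 (by norm_num)).mul_left B)
  refine Summable.of_norm_bounded h1 fun m => ?_
  rw [Real.norm_eq_abs, abs_mul, abs_of_pos (hh.pos m)]
  calc h m * |D m| ≤ (1 / 2) ^ m * (A + B * m) :=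
        mul_le_mul (hh.le_pow m) (hD m) (abs_nonneg _) (by positivity)
    _ = _ := by ring

theorem summable_mul_of_bounded (hh : IsHalving h) {D : ℕ → ℝ} {A : ℝ}
    (hD : ∀ m, |D m| ≤ A) : Summable fun m => h m * D m :=
  hh.summable_mul_of_linear (A := A) (B := 0) fun m => by simpa using hD m

theorem summable (hh : IsHalving h) : Summable h := by
  simpa using hh.summable_mul_of_bounded (D := fun _ => 1) (A := 1) (by simp)

theorem hasSum_drops (hh : IsHalving h) (k : ℕ) : HasSum (fun j => drops h (j + k)) (h k) := by
  have h1 := (summable_nat_add_iff k).2 hh.summable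
  have h2 := (summable_nat_add_iff (k + 1)).2 hh.summable
  have h3 : ∀ j, h (j + (k + 1)) = h (j + 1 + k) := fun j => by congr 1; ring
  have h4 := h1.hasSum.sub h2.hasSum
  rw [h1.tsum_eq_zero_add] at h4
  simp only [h3, zero_add, add_sub_cancel_right] at h4
  have h5 : ∀ j, h (j + k + 1) = h (j + 1 + k) := fun j => by congr 1; ring
  simpa only [drops, h5] using h4

/-- The tail of the drops telescopes to `h (m + 1)`, so dominance is the halving inequality itself.
-/
theorem isHalvingWeight (hh : IsHalving h) : IsHalvingWeight (drops h) where
  pos m := by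
    have := hh.two_mul_le m
    have := hh.pos (m + 1)
    unfold drops
    linarith
  summable := (hh.hasSum_drops 0).summable
  tail_le m := by
    rw [(hh.hasSum_drops (m + 1)).tsum_eq, drops]
    linarith [hh.two_mul_le m]

theorem tsum_drops (hh : IsHalving h) : ∑' j, drops h j = 1 := by
  have := (hh.hasSum_drops 0).tsum_eq
  rwa [hh.zero] at this

theorem summable_drops_mul (hh : IsHalving h) {D : ℕ → ℝ} {A B : ℝ}
    (hD : ∀ m, |D m| ≤ A + B * m) : Summable fun m => drops h m * D m := by
  refine Summable.of_norm_bounded (hh.summable_mul_of_linear hD).norm fun m => ?_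
  rw [norm_mul, norm_mul]
  refine mul_le_mul_of_nonneg_right ?_ (norm_nonneg _)
  rw [Real.norm_eq_abs, Real.norm_eq_abs, abs_of_pos (hh.isHalvingWeight.pos m),
    abs_of_pos (hh.pos m), drops]
  linarith [hh.pos (m + 1)]

/-- Summation by parts. -/
theorem tsum_mul_sub (hh : IsHalving h) {D : ℕ → ℝ} {A B : ℝ}
    (hD : ∀ m, |D m| ≤ A + B * m) :
    ∑' m, h m * (D (m + 1) - D m) = -D 0 + ∑' m, drops h m * D (m + 1) := by
  have hD' : ∀ m, |D (m + 1)| ≤ (A + B) + B * m := fun m => by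
    have := hD (m + 1)
    push_cast at this
    linarith
  have h1 := hh.summable_mul_of_linear hD
  have h2 := hh.summable_mul_of_linear hD'
  have h3 := hh.summable_drops_mul hD'
  have e1 : ∑' m, h m * (D (m + 1) - D m) = ∑' m, h m * D (m + 1) - ∑' m, h m * D m := by
    rw [← h2.tsum_sub h1]
    exact tsum_congr fun m => by ring
  have h4 : Summable fun m => h (m + 1) * D (m + 1) := (summable_nat_add_iff 1).2 h1
  have e2 : ∑' m, drops h m * D (m + 1) =
      ∑' m, h m * D (m + 1) - ∑' m, h (m + 1) * D (m + 1) := by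
    rw [← h2.tsum_sub h4]
    exact tsum_congr fun m => by rw [drops]; ring
  rw [e1, e2, h1.tsum_eq_zero_add, hh.zero]
  ring

/-- Summation by parts gives `(τ_n - ∑ v m τ_{n+1+m}) / 2`, which is `τ_n` times `(1 - corr) / 2`;
the second factor is nonnegative since the mass is `1`. -/
theorem abs_tsum_eq_corr (hh : IsHalving h) {s : ℕ → ℝ} {τ : ℕ → Bool}
    (hs : ∀ n, s n = (sgn (τ n) - sgn (τ (n + 1))) / 2) (n : ℕ) :
    |∑' m, h m * s (n + m)| = (1 - corr (drops h) τ n) / 2 := by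
  have h1 := hh.tsum_mul_sub (D := fun m => -sgn (τ (n + m)) / 2) (A := 1 / 2) (B := 0)
    fun m => by simp [abs_div, abs_sgn]
  have e : ∑' m, h m * s (n + m) = (sgn (τ n) - ∑' m, drops h m * sgn (τ (n + 1 + m))) / 2 := by
    have e1 : ∀ m, drops h m * (-sgn (τ (n + (m + 1))) / 2) =
        (drops h m * sgn (τ (n + 1 + m))) * (-1 / 2) := fun m => by
      rw [show n + (m + 1) = n + 1 + m by ring]; ring
    simp only [e1, tsum_mul_right, add_zero] at h1
    have e2 : ∀ m, h m * s (n + m) =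
        h m * (-sgn (τ (n + (m + 1))) / 2 - -sgn (τ (n + m)) / 2) := fun m => by
      rw [hs, add_assoc]; ring
    simp only [e2, h1]
    ring
  have hc := hh.isHalvingWeight.corr_le_tsum τ n
  rw [hh.tsum_drops] at hc
  have e3 : ∑' m, h m * s (n + m) = sgn (τ n) * ((1 - corr (drops h) τ n) / 2) := by
    rw [e, corr]
    linear_combination (1 / 2 * ∑' m, drops h m * sgn (τ (n + 1 + m))) * sgn_mul_self (τ n)
  rw [e3, abs_mul, abs_sgn, one_mul, abs_of_nonneg (by linarith)]

/-! ### Small weighted sums force two-valued partial sums -/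

/-- The negated partial sums of an integer sequence. -/
def negSum (s : ℕ → ℤ) (n : ℕ) : ℤ := -∑ i ∈ Finset.range n, s i

theorem negSum_succ (s : ℕ → ℤ) (n : ℕ) : negSum s (n + 1) = negSum s n - s n := by
  rw [negSum, negSum, Finset.sum_range_succ]
  ring

theorem abs_negSum_sub_le {s : ℕ → ℤ} {B : ℝ} (hB : ∀ n, |(s n : ℝ)| ≤ B) (n m : ℕ) :
    |(negSum s n : ℝ) - negSum s (n + m)| ≤ B * m := by
  induction m with
  | zero => simp
  | succ m ih =>
    rw [← add_assoc, negSum_succ]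
    push_cast
    have h1 := hB (n + m)
    rw [show (negSum s n : ℝ) - (negSum s (n + m) - s (n + m)) =
      ((negSum s n : ℝ) - negSum s (n + m)) + s (n + m) by ring]
    refine (abs_add_le _ _).trans ?_
    linarith

theorem tsum_eq_drops_negSum (hh : IsHalving h) {s : ℕ → ℤ} {B : ℝ}
    (hB : ∀ n, |(s n : ℝ)| ≤ B) (n : ℕ) :
    ∑' m, h m * (s (n + m) : ℝ) =
      ∑' m, drops h m * ((negSum s n : ℝ) - negSum s (n + 1 + m)) := by
  have h1 := hh.tsum_mul_sub (D := fun m => (negSum s n : ℝ) - negSum s (n + m)) (A := 0) (B := B)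
    fun m => by simpa using abs_negSum_sub_le hB n m
  simp only [add_zero, sub_self, neg_zero, zero_add] at h1
  have h2 : ∀ m, n + 1 + m = n + (m + 1) := fun m => by ring
  simp only [h2]
  rw [← h1]
  refine tsum_congr fun m => ?_
  rw [← add_assoc, negSum_succ]
  push_cast
  ring

/-- The surplus of at least `v k` at `k`, where `D` first differs from `1`, pays for a loss of `v m`
at every later `m`. The sequence `q` absorbs any further loss. -/
theorem _root_.MarkoffLagrange.IsHalvingWeight.neg_tsum_le_tsum_mul {v : ℕ → ℝ}
    (hv : IsHalvingWeight v) {D q : ℕ → ℝ} {k : ℕ} (hq : ∀ m, 0 ≤ q m) (hqs : Summable q)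
    (hD : ∀ m, -(v m) - q m ≤ v m * (D m - 1)) (hsum : Summable fun m => v m * (D m - 1))
    (h1 : ∀ m < k, D m = 1) (h2 : 2 ≤ D k) :
    -∑' m, q m ≤ ∑' m, v m * (D m - 1) := by
  have h4 : v k ≤ ∑ m ∈ Finset.range (k + 1), v m * (D m - 1) := by
    rw [Finset.sum_range_succ, Finset.sum_eq_zero fun m hm => ?_, zero_add]
    · nlinarith [hv.pos k]
    · simp [h1 m (Finset.mem_range.1 hm)]
  have h5 : -(∑' j, v (j + (k + 1))) - ∑' j, q (j + (k + 1)) ≤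
      ∑' j, v (j + (k + 1)) * (D (j + (k + 1)) - 1) := by
    have e1 := (hv.summable_tail (k + 1)).neg
    have e2 := (summable_nat_add_iff (k + 1)).2 hqs
    have e3 := (summable_nat_add_iff (k + 1)).2 hsum
    rw [← tsum_neg, ← e1.tsum_sub e2]
    exact (e1.sub e2).tsum_le_tsum (fun j => hD (j + (k + 1))) e3
  have h6 : ∑' j, q (j + (k + 1)) ≤ ∑' j, q j := by
    rw [← hqs.sum_add_tsum_nat_add (k + 1)]
    have : 0 ≤ ∑ m ∈ Finset.range (k + 1), q m := Finset.sum_nonneg fun m _ => hq m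
    linarith
  have h7 := hsum.sum_add_tsum_nat_add (k + 1)
  have h8 := hv.tail_le k
  linarith

/-- A drop by two below a maximum, after values one below it, would make the weighted sum at `n` at
least `1` up to a small error. No global maximum is available yet, so maximality is assumed only up
to `b`; `R` makes the contribution from beyond the window less than `1 - c`. -/
theorem exists_window (hh : IsHalving h) {s : ℕ → ℤ} {B c : ℝ}
    (hB : ∀ n, |(s n : ℝ)| ≤ B) (hc : c < 1) (hs : ∀ n, |∑' m, h m * (s (n + m) : ℝ)| ≤ c) :
    ∃ R, ∀ n k b, (∀ m < k, negSum s (n + 1 + m) = negSum s n - 1) → n + 1 + k + R ≤ b →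
      (∀ i, n ≤ i → i ≤ b → negSum s i ≤ negSum s n) →
      negSum s n - 1 ≤ negSum s (n + 1 + k) := by
  have hv := hh.isHalvingWeight
  have hB0 : 0 ≤ B := (abs_nonneg _).trans (hB 0)
  set q : ℕ → ℝ := fun m => drops h m * (B + B * m) with hq
  have hq0 : ∀ m, 0 ≤ q m := fun m => mul_nonneg (hv.pos m).le (by positivity)
  have hqs : Summable q := hh.summable_drops_mul (A := B) (B := B) fun m => by
    rw [abs_of_nonneg (by positivity)]
  obtain ⟨R, hR⟩ := ((tendsto_sum_nat_add q).eventually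
    (gt_mem_nhds (show (0 : ℝ) < 1 - c by linarith))).exists
  refine ⟨R, fun n k b h1 hb h2 => ?_⟩
  by_contra h3
  set D : ℕ → ℝ := fun m => (negSum s n : ℝ) - negSum s (n + 1 + m) with hD
  have h3' : (2 : ℝ) ≤ D k := by
    have : negSum s (n + 1 + k) ≤ negSum s n - 2 := by omega
    have : (negSum s (n + 1 + k) : ℝ) ≤ negSum s n - 2 := by exact_mod_cast this
    simp only [hD]
    linarith
  have hDb : ∀ m, |D m| ≤ B + B * m := fun m => by
    have := abs_negSum_sub_le hB n (1 + m)
    rw [← add_assoc] at this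
    push_cast at this
    linarith
  have hsD := hh.summable_drops_mul hDb
  have hsum : Summable fun m => drops h m * (D m - 1) :=
    (hsD.sub hv.summable).congr fun m => by ring
  have e1 : ∑' m, drops h m * (D m - 1) = ∑' m, h m * (s (n + m) : ℝ) - 1 := by
    rw [hh.tsum_eq_drops_negSum hB, ← hsum.hasSum.tsum_eq]
    have : ∑' m, drops h m * D m - ∑' m, drops h m = ∑' m, drops h m * (D m - 1) := by
      rw [← hsD.tsum_sub hv.summable]
      exact tsum_congr fun m => by ring
    rw [← this, hh.tsum_drops]
  -- Inside the window maximality gives `0 ≤ D m`, so the error is needed only from index `R` on.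
  set q' : ℕ → ℝ := fun m => if m < R then 0 else q m with hq'
  have hq'0 : ∀ m, 0 ≤ q' m := fun m => by
    simp only [hq']
    split_ifs
    exacts [le_rfl, hq0 m]
  have hq's : Summable q' := Summable.of_nonneg_of_le hq'0 (fun m => by
    simp only [hq']
    split_ifs
    exacts [hq0 m, le_rfl]) hqs
  have e2 : ∑' m, q' m = ∑' m, q (m + R) := by
    rw [← hq's.sum_add_tsum_nat_add R, Finset.sum_eq_zero fun m hm => by
      simp [hq', Finset.mem_range.1 hm], zero_add]
    exact tsum_congr fun m => by simp [hq']
  have hD0 : ∀ m, -(drops h m) - q' m ≤ drops h m * (D m - 1) := fun m => by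
    by_cases hm : m < R
    · have : negSum s (n + 1 + m) ≤ negSum s n := h2 _ (by omega) (by omega)
      have : (0 : ℝ) ≤ D m := by
        simp only [hD, sub_nonneg]; exact_mod_cast this
      simp only [hq', hm, if_true]
      nlinarith [hv.pos m]
    · simp only [hq', hm, if_false, hq]
      have := neg_le_of_abs_le (hDb m)
      nlinarith [hv.pos m]
  have h4 := hv.neg_tsum_le_tsum_mul hq'0 hq's hD0 hsum
    (fun m hm => by simp [hD, h1 m hm]) h3'
  have h9 := le_of_abs_le (hs n)
  linarith

theorem exists_window_two_valued (hh : IsHalving h) {s : ℕ → ℤ} {B c : ℝ}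
    (hB : ∀ n, |(s n : ℝ)| ≤ B) (hc : c < 1) (hs : ∀ n, |∑' m, h m * (s (n + m) : ℝ)| ≤ c) :
    ∃ R, ∀ a b, (∀ i, a ≤ i → i ≤ b → negSum s i ≤ negSum s a) →
      ∀ i, a ≤ i → i + R ≤ b → negSum s a - 1 ≤ negSum s i := by
  obtain ⟨R, hR⟩ := hh.exists_window hB hc hs
  refine ⟨R, fun a b hab i hai hib => ?_⟩
  -- Here `n` is the last visit to the maximal level up to `a + j`; the next value either returns to
  -- that level or prolongs the run one below it.
  have key : ∀ j, a + j + R ≤ b → ∃ n k, n + k = a + j ∧ a ≤ n ∧ negSum s n = negSum s a ∧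
      ∀ m < k, negSum s (n + 1 + m) = negSum s n - 1 := by
    intro j
    induction j with
    | zero => exact fun _ => ⟨a, 0, rfl, le_rfl, rfl, by simp⟩
    | succ j ih =>
      intro hj
      obtain ⟨n, k, hnk, han, hna, hk⟩ := ih (by omega)
      have h1 := hR n k b hk (by omega) fun i hi hi' => hna ▸ hab i (by omega) hi'
      have h2 := hab (n + 1 + k) (by omega) (by omega)
      rcases (show negSum s (n + 1 + k) = negSum s a ∨ negSum s (n + 1 + k) = negSum s n - 1 by
        omega) with h3 | h3
      · exact ⟨n + 1 + k, 0, by omega, by omega, h3, by simp⟩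
      · refine ⟨n, k + 1, by omega, han, hna, fun m hm => ?_⟩
        rcases Nat.lt_succ_iff_lt_or_eq.1 hm with hm | rfl
        exacts [hk m hm, h3]
  obtain ⟨n, k, hnk, han, hna, hk⟩ := key (i - a) (by omega)
  rcases k with _ | k
  · rw [show i = n by omega, hna]; omega
  · have := hk k (by omega)
    rw [show i = n + 1 + k by omega, this, hna]

/-- Take a maximum on `[0, m]`; it is at least `negSum s 0 = 0`. Up to `m - R` the sums stay at most
one below it, and the last `R` steps cost at most `B` each. -/
theorem exists_negSum_sub_le (hh : IsHalving h) {s : ℕ → ℤ} {B c : ℝ}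
    (hB : ∀ n, |(s n : ℝ)| ≤ B) (hc : c < 1) (hs : ∀ n, |∑' m, h m * (s (n + m) : ℝ)| ≤ c) :
    ∃ C : ℝ, ∀ n, -(negSum s n : ℝ) ≤ C := by
  obtain ⟨R, hR⟩ := hh.exists_window_two_valued hB hc hs
  have hB0 : 0 ≤ B := (abs_nonneg _).trans (hB 0)
  refine ⟨1 + B * R, fun m => ?_⟩
  obtain ⟨a, ha, hmax⟩ := Finset.exists_max_image (Finset.range (m + 1)) (negSum s) ⟨0, by simp⟩
  rw [Finset.mem_range] at ha
  have h0 : (0 : ℝ) ≤ negSum s a := by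
    have := hmax 0 (by simp)
    simp only [negSum, Finset.range_zero, Finset.sum_empty, neg_zero] at this
    exact_mod_cast this
  by_cases h : a + R ≤ m
  · have h1 := hR a m (fun i _ hi => hmax i (by simp; omega)) (m - R) (by omega) (by omega)
    have h2 := le_of_abs_le (abs_negSum_sub_le hB (m - R) R)
    rw [Nat.sub_add_cancel (by omega)] at h2
    have h1' : (negSum s a : ℝ) - 1 ≤ negSum s (m - R) := by exact_mod_cast h1
    linarith
  · have h2 := le_of_abs_le (abs_negSum_sub_le hB a (m - a))
    rw [Nat.add_sub_cancel' (by omega)] at h2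
    have : B * ((m - a : ℕ) : ℝ) ≤ B * R :=
      mul_le_mul_of_nonneg_left (by exact_mod_cast (by omega)) hB0
    linarith

/-- Bounded integer sequences with small weighted sums are eventually differences of a
two-valued sequence. -/
theorem exists_two_valued (hh : IsHalving h) {s : ℕ → ℤ} {B c : ℝ}
    (hB : ∀ n, |(s n : ℝ)| ≤ B) (hc : c < 1) (hs : ∀ n, |∑' m, h m * (s (n + m) : ℝ)| ≤ c) :
    ∃ (N : ℕ) (τ : ℕ → Bool), ∀ n,
      (s (n + N) : ℝ) = (sgn (τ n) - sgn (τ (n + 1))) / 2 := by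
  -- Applied to `-s`, the lower bound becomes an upper bound for `negSum s`. A global maximum `M` is
  -- then attained at some `a`, and windows of any length starting at `a` leave only `M` and `M -
  -- 1`.
  obtain ⟨C, hC⟩ := hh.exists_negSum_sub_le (s := fun n => -s n) (B := B) (c := c)
    (by simpa using hB) hc (by simpa [tsum_neg] using hs)
  have hC' : ∀ n, (negSum s n : ℝ) ≤ C := fun n => by
    have := hC n
    simpa [negSum] using this
  obtain ⟨M, ⟨a, ha⟩, hM⟩ := Int.exists_greatest_of_bdd (P := fun z => ∃ n, negSum s n = z)
    ⟨⌊C⌋, by rintro _ ⟨n, rfl⟩; exact Int.le_floor.2 (hC' n)⟩ ⟨_, 0, rfl⟩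
  obtain ⟨R, hR⟩ := hh.exists_window_two_valued hB hc hs
  have h1 : ∀ i, a ≤ i → negSum s i = M ∨ negSum s i = M - 1 := fun i hi => by
    have h2 := hR a (i + R) (fun j _ _ => ha ▸ hM _ ⟨j, rfl⟩) i hi le_rfl
    have h3 := hM _ ⟨i, rfl⟩
    omega
  refine ⟨a, fun n => decide (negSum s (n + a) = M), fun n => ?_⟩
  have h2 := negSum_succ s (n + a)
  have h3 : s (n + a) = negSum s (n + a) - negSum s (n + 1 + a) := by
    rw [add_right_comm]; omega
  rw [h3]
  rcases h1 (n + a) (by omega) with h4 | h4 <;> rcases h1 (n + 1 + a) (by omega) with h5 | h5 <;>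
    norm_num [h4, h5, sgn]

end IsHalving

/-! ### Partial fractions for complete homogeneous sums -/

section Algebra

variable {d : ℕ} {α : Fin d → ℂ}

/-- The Lagrange coefficients `∏_{j ≠ i} X_i / (X_i - X_j)`. -/
def lagrangeCoeff (x : Fin d → ℂ) (i : Fin d) : ℂ :=
  ∏ j ∈ Finset.univ.erase i, x i / (x i - x j)

/-- This is Lagrange interpolation of the constant `1` at the nodes `α i`, with each factor rescaled
to constant term `1`. -/
theorem sum_lagrangeCoeff_mul_prod (hd : 1 ≤ d) (hα : Function.Injective α) (h0 : ∀ i, α i ≠ 0) :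
    ∑ i, C (lagrangeCoeff (fun i => (α i)⁻¹) i) *
      ∏ j ∈ Finset.univ.erase i, (1 - C (α j)⁻¹ * X) = (1 : ℂ[X]) := by
  have : Nonempty (Fin d) := ⟨⟨0, hd⟩⟩
  refine (Finset.sum_congr rfl fun i _ => ?_).trans
    (Lagrange.sum_basis (s := Finset.univ) (v := α) hα.injOn Finset.univ_nonempty)
  rw [Lagrange.basis, lagrangeCoeff, map_prod, ← Finset.prod_mul_distrib]
  refine Finset.prod_congr rfl fun j hj => ?_
  have hij : α i - α j ≠ 0 := sub_ne_zero.2 fun h => Finset.ne_of_mem_erase hj (hα h).symm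
  have hji : α j - α i ≠ 0 := sub_ne_zero.2 fun h => Finset.ne_of_mem_erase hj (hα h)
  have e1 : (α i)⁻¹ / ((α i)⁻¹ - (α j)⁻¹) = α j * (α j - α i)⁻¹ := by
    have := h0 i
    have := h0 j
    rw [inv_sub_inv (h0 i) (h0 j)]
    field_simp
  have e2 : (α i - α j)⁻¹ = -(α j - α i)⁻¹ := by rw [← inv_neg, neg_sub]
  rw [Lagrange.basisDivisor, e1, e2]
  have e3 : (1 : ℂ[X]) = C (α j) * C (α j)⁻¹ := by
    rw [← C_mul, mul_inv_cancel₀ (h0 j), C_1]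
  simp only [map_mul, map_neg]
  linear_combination (C (α j - α i)⁻¹ * X) * e3

/-- The geometric power series. -/
def geom (x : ℂ) : PowerSeries ℂ := PowerSeries.mk fun n => x ^ n

theorem one_sub_mul_geom (x : ℂ) : (1 - PowerSeries.C x * PowerSeries.X) * geom x = 1 := by
  ext n
  rw [sub_mul, one_mul, map_sub, mul_assoc, PowerSeries.coeff_C_mul]
  rcases n with _ | n
  · simp [geom]
  · rw [PowerSeries.coeff_succ_X_mul]
    simp [geom, PowerSeries.coeff_one, pow_succ']

theorem mk_completeH (x : Fin d → ℂ) :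
    PowerSeries.mk (fun m => completeH m x) = ∏ j, geom (x j) := by
  ext m
  rw [PowerSeries.coeff_mk, PowerSeries.coeff_prod, completeH]
  refine Finset.sum_bij' (fun f _ => Finsupp.equivFunOnFinite.symm f) (fun l _ => l)
    ?_ ?_ ?_ ?_ ?_
  · intro f hf
    simpa [Finset.mem_finsuppAntidiag] using hf
  · intro l hl
    simpa [Finset.mem_finsuppAntidiag] using hl
  · intro f _
    rfl
  · intro l _
    ext; rfl
  · intro f _
    simp [geom]

theorem completeH_eq_sum (hd : 1 ≤ d) (hα : Function.Injective α) (h0 : ∀ i, α i ≠ 0) (m : ℕ) :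
    completeH m (fun i => (α i)⁻¹) =
      ∑ i, lagrangeCoeff (fun i => (α i)⁻¹) i * (α i)⁻¹ ^ m := by
  have h1 := congrArg (fun p : ℂ[X] => (p : PowerSeries ℂ)) (sum_lagrangeCoeff_mul_prod hd hα h0)
  have h2 : ∏ j, geom (α j)⁻¹ =
      ∑ i, PowerSeries.C (lagrangeCoeff (fun i => (α i)⁻¹) i) * geom (α i)⁻¹ := by
    have h3 : (1 : PowerSeries ℂ) = ∑ i, PowerSeries.C (lagrangeCoeff (fun i => (α i)⁻¹) i) *
        ∏ j ∈ Finset.univ.erase i, (1 - PowerSeries.C (α j)⁻¹ * PowerSeries.X) := by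
      refine (Polynomial.coe_one.symm.trans h1.symm).trans ?_
      simp only [← Polynomial.coeToPowerSeries.ringHom_apply, map_sum, map_mul, map_prod, map_sub,
        map_one]
      simp only [Polynomial.coeToPowerSeries.ringHom_apply, Polynomial.coe_C, Polynomial.coe_X]
    rw [← mul_one (∏ j, geom (α j)⁻¹), h3, Finset.mul_sum]
    refine Finset.sum_congr rfl fun i _ => ?_
    rw [← Finset.mul_prod_erase _ _ (Finset.mem_univ i)]
    have h4 : (∏ j ∈ Finset.univ.erase i, geom (α j)⁻¹) *
        ∏ j ∈ Finset.univ.erase i, (1 - PowerSeries.C (α j)⁻¹ * PowerSeries.X) = 1 := by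
      rw [← Finset.prod_mul_distrib]
      exact Finset.prod_eq_one fun j _ => by rw [mul_comm, one_sub_mul_geom]
    linear_combination (geom (α i)⁻¹ * PowerSeries.C (lagrangeCoeff (fun i => (α i)⁻¹) i)) * h4
  have h3 := congrArg (PowerSeries.coeff m) ((mk_completeH fun i => (α i)⁻¹).trans h2)
  simpa [geom] using h3

theorem completeH_zero (x : Fin d → ℂ) : completeH 0 x = 1 := by
  simp [completeH]

end Algebra

/-! ### Factorization of `P` and the coefficients of `1 / P` -/

section Roots

variable {d : ℕ} {α : Fin d → ℂ} {P : ℤ[X]}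

theorem map_eq_prod (hmonic : P.Monic) (hα : complexRoots P = Finset.univ.val.map α) :
    P.map (Int.castRingHom ℂ) = ∏ i, (X - C (α i)) := by
  have h := (IsAlgClosed.splits (P.map (Int.castRingHom ℂ))).eq_prod_roots_of_monic
    (hmonic.map _)
  rw [h]
  unfold complexRoots at hα
  rw [hα, Multiset.map_map]
  rfl

theorem map_eq_C_mul_prod (hmonic : P.Monic) (hα : complexRoots P = Finset.univ.val.map α)
    (h0 : ∀ i, α i ≠ 0) :
    P.map (Int.castRingHom ℂ) = C (P.coeff 0 : ℂ) * ∏ i, (1 - C (α i)⁻¹ * X) := by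
  have h1 := map_eq_prod hmonic hα
  have h2 : (P.coeff 0 : ℂ) = ∏ i, -α i := by
    have := congrArg (eval 0) h1
    simpa [eval_prod, ← coeff_zero_eq_eval_zero] using this
  rw [h1, h2, map_prod, ← Finset.prod_mul_distrib]
  refine Finset.prod_congr rfl fun i _ => ?_
  have e3 : (1 : ℂ[X]) = C (α i) * C (α i)⁻¹ := by
    rw [← C_mul, mul_inv_cancel₀ (h0 i), C_1]
  rw [C_neg]
  linear_combination X * e3

theorem aeval_eq_mul_prod (hmonic : P.Monic) (hα : complexRoots P = Finset.univ.val.map α)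
    (h0 : ∀ i, α i ≠ 0) (z : ℂ) :
    aeval z P = (P.coeff 0 : ℂ) * ∏ i, (1 - (α i)⁻¹ * z) := by
  have := congrArg (eval z) (map_eq_C_mul_prod hmonic hα h0)
  rw [eval_map, ← algebraMap_int_eq, ← aeval_def] at this
  rw [this]
  simp [eval_prod]

/-- The numbers `H^{(m)}(α⁻¹) / a_0` are the coefficients of `1 / P`. -/
theorem sum_coeff_mul_completeH (hmonic : P.Monic)
    (hα : complexRoots P = Finset.univ.val.map α) (h0 : ∀ i, α i ≠ 0) (j : ℕ) :
    ∑ k ∈ Finset.range (j + 1), (P.coeff k : ℂ) * completeH (j - k) (fun i => (α i)⁻¹) =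
      if j = 0 then (P.coeff 0 : ℂ) else 0 := by
  have h1 := congrArg (fun p : ℂ[X] => (p : PowerSeries ℂ)) (map_eq_C_mul_prod hmonic hα h0)
  have h2 : ((P.map (Int.castRingHom ℂ) : ℂ[X]) : PowerSeries ℂ) *
      PowerSeries.mk (fun m => completeH m fun i => (α i)⁻¹) = PowerSeries.C (P.coeff 0 : ℂ) := by
    rw [mk_completeH]
    rw [h1]
    simp only [← Polynomial.coeToPowerSeries.ringHom_apply, map_mul, map_prod, map_sub, map_one]
    simp only [Polynomial.coeToPowerSeries.ringHom_apply, Polynomial.coe_C, Polynomial.coe_X]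
    rw [mul_assoc, ← Finset.prod_mul_distrib, Finset.prod_eq_one, mul_one]
    exact fun j _ => one_sub_mul_geom _
  have h3 := congrArg (PowerSeries.coeff j) h2
  rw [PowerSeries.coeff_mul, Finset.Nat.sum_antidiagonal_eq_sum_range_succ_mk,
    PowerSeries.coeff_C] at h3
  simpa using h3

end Roots

/-! ### The contour integrals as Taylor coefficients -/

section Rho

variable {d : ℕ} {α : Fin d → ℂ} {P : ℤ[X]}

theorem hasSum_completeH (hd : 1 ≤ d) (hmonic : P.Monic)
    (hα : complexRoots P = Finset.univ.val.map α) (hinj : Function.Injective α)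
    (h0 : ∀ i, α i ≠ 0) (ha : (P.coeff 0 : ℂ) ≠ 0) {z : ℂ} (hz : ∀ i, ‖(α i)⁻¹ * z‖ < 1) :
    HasSum (fun m => z ^ m * (completeH m (fun i => (α i)⁻¹) / P.coeff 0)) (aeval z P)⁻¹ := by
  have h1 := congrArg (eval z) (sum_lagrangeCoeff_mul_prod hd hinj h0)
  simp only [eval_finsetSum, eval_mul, eval_C, eval_prod, eval_sub, eval_one, eval_X] at h1
  have hne : ∀ i, 1 - (α i)⁻¹ * z ≠ 0 := fun i h => by
    have := hz i
    rw [← sub_eq_zero.1 h] at this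
    simp at this
  have h2 : (aeval z P)⁻¹ =
      ∑ i, (lagrangeCoeff (fun i => (α i)⁻¹) i / P.coeff 0) * (1 - (α i)⁻¹ * z)⁻¹ := by
    rw [aeval_eq_mul_prod hmonic hα h0]
    refine inv_eq_of_mul_eq_one_right ?_
    rw [Finset.mul_sum]
    refine (Finset.sum_congr rfl fun i _ => ?_).trans h1
    rw [← Finset.mul_prod_erase _ _ (Finset.mem_univ i)]
    have := hne i
    generalize 1 - (α i)⁻¹ * z = u at *
    field_simp
  rw [h2]
  have h3 : ∀ m, z ^ m * (completeH m (fun i => (α i)⁻¹) / P.coeff 0) =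
      ∑ i, (lagrangeCoeff (fun i => (α i)⁻¹) i / P.coeff 0) * ((α i)⁻¹ * z) ^ m := fun m => by
    rw [completeH_eq_sum hd hinj h0, Finset.sum_div, Finset.mul_sum]
    refine Finset.sum_congr rfl fun i _ => ?_
    rw [mul_pow]
    ring
  simp only [h3]
  exact hasSum_sum fun i _ => (hasSum_geometric_of_norm_lt_one (hz i)).mul_left _

/-- For `1 < r < min ‖α i‖` the function `1 / P` is holomorphic on the closed disc of radius `r`, so
by Cauchy's formula the integral is a Taylor coefficient at `0`, independent of `r`. -/
theorem rho_neg (hd : 1 ≤ d) (hmonic : P.Monic)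
    (hα : complexRoots P = Finset.univ.val.map α) (hinj : Function.Injective α)
    (h1 : ∀ i, 1 < ‖α i‖) (m : ℕ) :
    rho P (-(m : ℤ)) = -(P.coeff 0 : ℂ)⁻¹ * completeH m (fun i => (α i)⁻¹) := by
  have h0 : ∀ i, α i ≠ 0 := fun i h => by
    have := h1 i
    rw [h, norm_zero] at this
    linarith
  have ha : (P.coeff 0 : ℂ) ≠ 0 := by
    intro h
    have h2 := map_eq_C_mul_prod hmonic hα h0
    rw [h, C_0, zero_mul] at h2
    exact (hmonic.map (Int.castRingHom ℂ)).ne_zero h2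
  have hev : ∀ᶠ r : ℝ in 𝓝[>] 1, 1 < r ∧ ∀ i, r < ‖α i‖ := by
    refine (eventually_mem_nhdsWithin).and ?_
    rw [eventually_all]
    exact fun i => nhdsWithin_le_nhds (eventually_lt_nhds (h1 i))
  refine Tendsto.limUnder_eq (tendsto_const_nhds.congr' ?_)
  filter_upwards [hev] with r hr
  have hr0 : 0 < r := by linarith [hr.1]
  have hlt : ∀ i z, ‖z‖ ≤ r → ‖(α i)⁻¹ * z‖ < 1 := fun i z hz => by
    have := hr.2 i
    rw [norm_mul, norm_inv, inv_mul_lt_iff₀ (by linarith), mul_one]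
    linarith
  have hP : ∀ z : ℂ, ‖z‖ ≤ r → aeval z P ≠ 0 := fun z hz => by
    rw [aeval_eq_mul_prod hmonic hα h0]
    refine mul_ne_zero ha (Finset.prod_ne_zero_iff.2 fun i _ h => ?_)
    have := hlt i z hz
    rw [← sub_eq_zero.1 h] at this
    simp at this
  have hdiff : DiffContOnCl ℂ (fun z : ℂ => (aeval z P)⁻¹) (Metric.ball 0 (r.toNNReal : ℝ)) := by
    rw [Real.coe_toNNReal _ hr0.le]
    refine DifferentiableOn.diffContOnCl fun z hz => ?_
    refine (DifferentiableAt.fun_inv (h := fun z : ℂ => aeval z P) ?_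
      (hP z ?_)).differentiableWithinAt
    · have := (P.map (Int.castRingHom ℂ)).differentiable z
      simpa only [eval_map, ← algebraMap_int_eq, ← aeval_def] using this
    · have := Metric.closure_ball_subset_closedBall hz
      simpa using this
  have hps := (hdiff.hasFPowerSeriesOnBall (Real.toNNReal_pos.2 hr0)).hasFPowerSeriesAt
  have hps' : HasFPowerSeriesAt (fun z : ℂ => (aeval z P)⁻¹)
      (FormalMultilinearSeries.ofScalars ℂ
        fun m => completeH m (fun i => (α i)⁻¹) / P.coeff 0) 0 := by
    rw [hasFPowerSeriesAt_iff]
    filter_upwards [Metric.closedBall_mem_nhds 0 hr0] with z hz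
    have := hasSum_completeH hd hmonic hα hinj h0 ha fun i => hlt i z (by simpa using hz)
    simpa only [FormalMultilinearSeries.coeff_ofScalars, zero_add, smul_eq_mul] using this
  have heq := congrArg (fun p => FormalMultilinearSeries.coeff p m)
    (hps.eq_formalMultilinearSeries hps')
  have e1 : FormalMultilinearSeries.coeff
      (cauchyPowerSeries (fun z : ℂ => (aeval z P)⁻¹) 0 (r.toNNReal : ℝ)) m =
      (2 * Real.pi * Complex.I : ℂ)⁻¹ • ∮ z in C(0, r), (1 / (z - 0)) ^ m • (z - 0)⁻¹ •
        (aeval z P)⁻¹ := by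
    rw [Real.coe_toNNReal _ hr0.le, ← cauchyPowerSeries_apply]
    rfl
  have e2 : (∮ z in C(0, r), z ^ (-(m : ℤ) - 1) / aeval z P) =
      ∮ z in C(0, r), (1 / (z - 0)) ^ m • (z - 0)⁻¹ • (aeval z P)⁻¹ := by
    refine circleIntegral.integral_congr hr0.le fun z hz => ?_
    have hz0 : z ≠ 0 := by
      rintro rfl
      simp at hz
      linarith
    simp only [sub_zero, smul_eq_mul]
    rw [zpow_sub_one₀ hz0, zpow_neg, zpow_natCast, one_div, inv_pow]
    ring
  simp only [e1, FormalMultilinearSeries.coeff_ofScalars, smul_eq_mul] at heq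
  simp only [e2, smul_eq_mul]
  rw [neg_mul, neg_mul, heq]
  ring

end Rho

/-! ### Solutions of the recurrence and bounded integer sequences -/

section Dynamics

variable {P : ℤ[X]} {h : ℕ → ℝ}

/-- `h / a_0` inverts the difference operator with characteristic polynomial `P`. -/
theorem IsHalving.sum_coeff_mul_tsum (hh : IsHalving h)
    (hconv : ∀ j, ∑ k ∈ Finset.range (j + 1), (P.coeff k : ℝ) * h (j - k) =
      if j = 0 then (P.coeff 0 : ℝ) else 0)
    {y : ℕ → ℝ} {A : ℝ} (hy : ∀ n, |y n| ≤ A) (n : ℕ) :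
    ∑ k ∈ Finset.range (P.natDegree + 1), (P.coeff k : ℝ) * ∑' m, h m * y (n + k + m) =
      P.coeff 0 * y n := by
  -- With `h` extended by zero to negative indices, all the sums run over the same `y (n + j)`,
  -- whose coefficient is the convolution in `hconv`.
  set f : ℕ → ℕ → ℝ := fun k j => (if k ≤ j then h (j - k) else 0) * y (n + j) with hf
  have hshift : ∀ k m, f k (m + k) = h m * y (n + k + m) := fun k m => by
    simp only [hf, Nat.le_add_left, if_true, Nat.add_sub_cancel]
    congr 2
    ring
  have hfs : ∀ k, Summable (f k) := fun k => by
    rw [← summable_nat_add_iff k]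
    simp only [hshift]
    exact hh.summable_mul_of_bounded fun m => hy _
  have h1 : ∀ k, ∑' m, h m * y (n + k + m) = ∑' j, f k j := fun k => by
    rw [← (hfs k).sum_add_tsum_nat_add k, Finset.sum_eq_zero fun j hj => ?_, zero_add]
    · simp only [hshift]
    · simp only [hf, if_neg (not_le.2 (Finset.mem_range.1 hj)), zero_mul]
  simp only [h1, ← tsum_mul_left]
  rw [← Summable.tsum_finsetSum fun k _ => (hfs k).mul_left _]
  have h2 : ∀ j, ∑ k ∈ Finset.range (P.natDegree + 1), (P.coeff k : ℝ) * f k j =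
      if j = 0 then P.coeff 0 * y n else 0 := fun j => by
    have h3 : ∑ k ∈ Finset.range (P.natDegree + 1), (P.coeff k : ℝ) * f k j =
        ∑ k ∈ Finset.range (P.natDegree + 1 + (j + 1)), (P.coeff k : ℝ) * f k j := by
      refine Finset.sum_subset (fun k hk => by simp at *; omega) fun k _ hk => ?_
      rw [coeff_eq_zero_of_natDegree_lt (by simp at hk; omega), Int.cast_zero, zero_mul]
    have h4 : ∑ k ∈ Finset.range (j + 1), (P.coeff k : ℝ) * f k j =
        ∑ k ∈ Finset.range (P.natDegree + 1 + (j + 1)), (P.coeff k : ℝ) * f k j := by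
      refine Finset.sum_subset (fun k hk => by simp at *; omega) fun k _ hk => ?_
      simp only [hf]
      rw [if_neg (by simp at hk; omega), zero_mul, mul_zero]
    rw [h3, ← h4]
    have h5 : ∑ k ∈ Finset.range (j + 1), (P.coeff k : ℝ) * f k j =
        (∑ k ∈ Finset.range (j + 1), (P.coeff k : ℝ) * h (j - k)) * y (n + j) := by
      rw [Finset.sum_mul]
      refine Finset.sum_congr rfl fun k hk => ?_
      simp only [hf]
      rw [if_pos (by simp at hk; omega), mul_assoc]
    rw [h5, hconv]
    split_ifs with hj
    · rw [hj, add_zero]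
    · rw [zero_mul]
  simp only [h2, tsum_ite_eq]

theorem recSeqC_isSolution (g : ℂ → ℂ) (n : ℕ) :
    ∑ k ∈ Finset.range (P.natDegree + 1), (P.coeff k : ℂ) * recSeqC P g (n + k) = 0 := by
  simp only [recSeqC, Finset.mul_sum]
  rw [Finset.sum_comm]
  refine Finset.sum_eq_zero fun z hz => ?_
  have hz' : eval₂ (Int.castRingHom ℂ) z P = 0 := by
    simp only [expandingRoots, complexRoots, Finset.mem_filter, Multiset.mem_toFinset,
      mem_roots', IsRoot.def, eval_map] at hz
    exact hz.1.2
  rw [eval₂_eq_sum_range] at hz'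
  have : ∀ k, (P.coeff k : ℂ) * (g z * z ^ (n + k)) =
      (Int.castRingHom ℂ (P.coeff k) * z ^ k) * (g z * z ^ n) := fun k => by
    rw [pow_add, eq_intCast]; ring
  simp only [this, ← Finset.sum_mul, hz', zero_mul]

theorem recSeq_isSolution (g : ℂ → ℂ) (n : ℕ) :
    ∑ k ∈ Finset.range (P.natDegree + 1), (P.coeff k : ℝ) * recSeq P g (n + k) = 0 := by
  have := congrArg Complex.re (recSeqC_isSolution (P := P) g n)
  simpa [recSeq] using this

theorem eq_of_isSolution {x y : ℕ → ℂ} (hmonic : P.Monic)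
    (hx : ∀ n, ∑ k ∈ Finset.range (P.natDegree + 1), (P.coeff k : ℂ) * x (n + k) = 0)
    (hy : ∀ n, ∑ k ∈ Finset.range (P.natDegree + 1), (P.coeff k : ℂ) * y (n + k) = 0)
    (h : ∀ n < P.natDegree, x n = y n) (n : ℕ) : x n = y n := by
  induction n using Nat.strong_induction_on with
  | _ n ih =>
  by_cases hn : n < P.natDegree
  · exact h n hn
  · have h1 := hx (n - P.natDegree)
    have h2 := hy (n - P.natDegree)
    rw [Finset.sum_range_succ, Nat.sub_add_cancel (not_lt.1 hn), hmonic.coeff_natDegree] at h1 h2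
    have h3 : ∑ k ∈ Finset.range P.natDegree, (P.coeff k : ℂ) * x (n - P.natDegree + k) =
        ∑ k ∈ Finset.range P.natDegree, (P.coeff k : ℂ) * y (n - P.natDegree + k) :=
      Finset.sum_congr rfl fun k hk => by
        rw [ih _ (by have := Finset.mem_range.1 hk; omega)]
    rw [h3] at h1
    simpa using add_left_cancel (h1.trans h2.symm)

theorem expandingRoots_eq {d : ℕ} {α : Fin d → ℂ} (hexp : IsExpanding P)
    (hα : complexRoots P = Finset.univ.val.map α) :
    expandingRoots P = Finset.univ.image α := by
  rw [expandingRoots, Finset.filter_true_of_mem fun z hz => hexp z (Multiset.mem_toFinset.1 hz), hα]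
  rfl

/-- Real solutions of the recurrence are of the form `x_n(g)`. -/
theorem exists_recSeq_eq {d : ℕ} {α : Fin d → ℂ} (hdeg : P.natDegree = d) (hmonic : P.Monic)
    (hexp : IsExpanding P) (hα : complexRoots P = Finset.univ.val.map α)
    (hinj : Function.Injective α) {x : ℕ → ℝ}
    (hx : ∀ n, ∑ k ∈ Finset.range (P.natDegree + 1), (P.coeff k : ℝ) * x (n + k) = 0) :
    ∃ g ∈ Xi P, ∀ n, recSeq P g n = x n := by
  -- The Vandermonde system matches the first `d` values; the recurrence then determines the rest.
  set V := Matrix.vandermonde α with hV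
  have hdet : IsUnit V.det := isUnit_iff_ne_zero.2 (Matrix.det_vandermonde_ne_zero_iff.2 hinj)
  set c : Fin d → ℂ := Matrix.vecMul (fun i : Fin d => (x i : ℂ)) V⁻¹ with hc
  have hcV : Matrix.vecMul c V = fun i : Fin d => (x i : ℂ) := by
    rw [hc, Matrix.vecMul_vecMul, Matrix.nonsing_inv_mul _ hdet, Matrix.vecMul_one]
  set g₀ : ℂ → ℂ := Function.extend α c 0 with hg₀
  have hrec : ∀ g n, recSeqC P g n = ∑ i, g (α i) * α i ^ n := fun g n => by
    rw [recSeqC, expandingRoots_eq hexp hα, Finset.sum_image hinj.injOn]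
  have h1 : ∀ n, recSeqC P g₀ n = x n := by
    refine eq_of_isSolution hmonic (recSeqC_isSolution g₀) (fun n => ?_) fun n hn => ?_
    · have := congrArg (fun r : ℝ => (r : ℂ)) (hx n)
      simpa using this
    · have := congrFun hcV ⟨n, hdeg ▸ hn⟩
      rw [hrec, ← this]
      simp [Matrix.vecMul, dotProduct, hV, Matrix.vandermonde_apply, hg₀, hinj.extend_apply]
  -- The conjugate solution represents the same real sequence, and its average with `g₀` satisfies
  -- the symmetry required by `Xi`.
  set g₁ : ℂ → ℂ := fun z => starRingEnd ℂ (g₀ (starRingEnd ℂ z)) with hg₁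
  have h2 : ∀ n, recSeqC P g₁ n = x n := fun n => by
    have h3 := congrArg (starRingEnd ℂ) (h1 n)
    rw [Complex.conj_ofReal] at h3
    rw [← h3, recSeqC, recSeqC, map_sum]
    refine Finset.sum_nbij' (starRingEnd ℂ) (starRingEnd ℂ)
      (fun z hz => conj_mem_expandingRoots hz) (fun z hz => conj_mem_expandingRoots hz)
      (fun z _ => by simp) (fun z _ => by simp) (fun z hz => ?_)
    simp [hg₁]
  refine ⟨fun z => (g₀ z + g₁ z) / 2, fun z _ => ?_, fun n => ?_⟩
  · simp [hg₁, add_comm, map_ofNat (starRingEnd ℂ) 2]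
  · have h3 : recSeqC P (fun z => (g₀ z + g₁ z) / 2) n =
        (recSeqC P g₀ n + recSeqC P g₁ n) / 2 := by
      simp only [recSeqC]
      rw [← Finset.sum_add_distrib, Finset.sum_div]
      exact Finset.sum_congr rfl fun z _ => by ring
    rw [recSeq, h3, h1, h2]
    simp

/-- The solution of an inhomogeneous integral recurrence with vanishing initial values. -/
def solveRec (P : ℤ[X]) (s : ℕ → ℤ) (n : ℕ) : ℤ :=
  if n < P.natDegree then 0
  else s (n - P.natDegree) -
    ∑ k : Fin P.natDegree, P.coeff k * solveRec P s (n - P.natDegree + k)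
termination_by n
decreasing_by omega

theorem solveRec_spec (hmonic : P.Monic) (s : ℕ → ℤ) (n : ℕ) :
    ∑ k ∈ Finset.range (P.natDegree + 1), P.coeff k * solveRec P s (n + k) = s n := by
  rw [Finset.sum_range_succ, hmonic.coeff_natDegree, one_mul, solveRec,
    if_neg (by omega), Nat.add_sub_cancel,
    Finset.sum_range fun k => P.coeff k * solveRec P s (n + k)]
  ring

theorem distInt_int_add {z : ℤ} {ε : ℝ} (hε : |ε| ≤ 1 / 2) : distInt (z + ε) = |ε| := by
  refine le_antisymm ?_ ?_
  · have := round_le (z + ε) z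
    rwa [add_sub_cancel_left] at this
  · by_cases h : round ((z : ℝ) + ε) = z
    · rw [distInt, h, add_sub_cancel_left]
    · have h1 : (1 : ℝ) ≤ |((z - round ((z : ℝ) + ε) : ℤ) : ℝ)| := by
        have := Int.one_le_abs (sub_ne_zero.2 (Ne.symm h))
        exact_mod_cast this
      have h2 : |((z - round ((z : ℝ) + ε) : ℤ) : ℝ)| ≤ distInt (z + ε) + |ε| := by
        have := abs_sub ((z : ℝ) + ε - round ((z : ℝ) + ε)) ε
        refine le_trans (le_of_eq ?_) this
        push_cast
        congr 1
        ring
      linarith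

/-- The fractional parts of a real solution come from a bounded integer sequence. -/
theorem IsHalving.exists_int_seq (hh : IsHalving h)
    (hconv : ∀ j, ∑ k ∈ Finset.range (j + 1), (P.coeff k : ℝ) * h (j - k) =
      if j = 0 then (P.coeff 0 : ℝ) else 0)
    (ha : (P.coeff 0 : ℝ) ≠ 0) (g : ℂ → ℂ) :
    ∃ (s : ℕ → ℤ) (B : ℝ), (∀ n, |(s n : ℝ)| ≤ B) ∧
      ∀ n, distInt (recSeq P g n) = |∑' m, h m * (s (n + m) : ℝ)| / |(P.coeff 0 : ℝ)| := by
  set ε : ℕ → ℝ := fun n => recSeq P g n - round (recSeq P g n) with hε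
  have hεb : ∀ n, |ε n| ≤ 1 / 2 := fun n => abs_sub_round _
  set s : ℕ → ℤ := fun n =>
    -∑ k ∈ Finset.range (P.natDegree + 1), P.coeff k * round (recSeq P g (n + k)) with hs
  have h1 : ∀ n, (s n : ℝ) = ∑ k ∈ Finset.range (P.natDegree + 1), (P.coeff k : ℝ) * ε (n + k) :=
    fun n => by
      simp only [hε, hs, mul_sub, Finset.sum_sub_distrib, recSeq_isSolution]
      push_cast
      ring
  refine ⟨s, ∑ k ∈ Finset.range (P.natDegree + 1), |(P.coeff k : ℝ)| * (1 / 2), fun n => ?_,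
    fun n => ?_⟩
  · rw [h1]
    refine (Finset.abs_sum_le_sum_abs _ _).trans (Finset.sum_le_sum fun k _ => ?_)
    rw [abs_mul]
    exact mul_le_mul_of_nonneg_left (hεb _) (abs_nonneg _)
  · have h2 : ∑' m, h m * (s (n + m) : ℝ) = P.coeff 0 * ε n := by
      rw [← hh.sum_coeff_mul_tsum hconv hεb n]
      simp only [← tsum_mul_left]
      rw [← Summable.tsum_finsetSum fun k _ =>
        (hh.summable_mul_of_bounded fun m => hεb (n + k + m)).mul_left _]
      refine tsum_congr fun m => ?_
      rw [h1, Finset.mul_sum]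
      refine Finset.sum_congr rfl fun k _ => ?_
      rw [add_right_comm n k m]
      ring
    rw [h2, abs_mul, mul_div_cancel_left₀ _ (abs_ne_zero.2 ha)]
    rfl

/-- Bounded integer sequences with small weighted sums come from real solutions. -/
theorem IsHalving.exists_mem_Xi (hh : IsHalving h)
    (hconv : ∀ j, ∑ k ∈ Finset.range (j + 1), (P.coeff k : ℝ) * h (j - k) =
      if j = 0 then (P.coeff 0 : ℝ) else 0)
    (ha : (P.coeff 0 : ℝ) ≠ 0) {d : ℕ} {α : Fin d → ℂ} (hdeg : P.natDegree = d)
    (hmonic : P.Monic) (hexp : IsExpanding P) (hα : complexRoots P = Finset.univ.val.map α)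
    (hinj : Function.Injective α) {s : ℕ → ℤ} {B : ℝ} (hB : ∀ n, |(s n : ℝ)| ≤ B)
    (hs : ∀ n, |∑' m, h m * (s (n + m) : ℝ)| / |(P.coeff 0 : ℝ)| ≤ 1 / 2) :
    ∃ g ∈ Xi P,
      ∀ n, distInt (recSeq P g n) = |∑' m, h m * (s (n + m) : ℝ)| / |(P.coeff 0 : ℝ)| := by
  set ε : ℕ → ℝ := fun n => (∑' m, h m * (s (n + m) : ℝ)) / P.coeff 0 with hε
  have h1 : ∀ n, ∑ k ∈ Finset.range (P.natDegree + 1), (P.coeff k : ℝ) * ε (n + k) = s n :=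
    fun n => by
      have h2 := hh.sum_coeff_mul_tsum hconv hB n
      simp only [hε, ← mul_div_assoc]
      rw [← Finset.sum_div, h2, mul_div_cancel_left₀ _ ha]
  -- The operator sends `ε` to `s`, so adding an integer solution for `-s`, which exists because `P`
  -- is monic, gives a homogeneous solution with the same distances to the integers.
  have h2 : ∀ n, ∑ k ∈ Finset.range (P.natDegree + 1), (P.coeff k : ℝ) *
      ((solveRec P (fun n => -s n) (n + k) : ℝ) + ε (n + k)) = 0 := fun n => by
    have h3 := congrArg (fun z : ℤ => (z : ℝ)) (solveRec_spec hmonic (fun n => -s n) n)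
    push_cast at h3
    simp only [mul_add, Finset.sum_add_distrib, h1, h3, neg_add_cancel]
  obtain ⟨g, hg, hgx⟩ := exists_recSeq_eq hdeg hmonic hexp hα hinj
    (x := fun n => (solveRec P (fun n => -s n) n : ℝ) + ε n) h2
  refine ⟨g, hg, fun n => ?_⟩
  rw [← abs_div] at *
  rw [hgx, distInt_int_add]
  simpa only [← abs_div] using hs n

end Dynamics

/-! ### Halving chains as real sequences -/

section Chain

open scoped ComplexOrder in
theorem halvingChain_iff (u : ℕ → ℂ) :
    HalvingChain u ↔ (∀ m, (u m).im = 0) ∧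
      ((∀ m, 2 * (u (m + 1)).re ≤ (u m).re ∧ 0 < (u m).re) ∨
        (∀ m, (u m).re ≤ 2 * (u (m + 1)).re ∧ (u m).re < 0)) := by
  have e : ∀ k : ℕ, (2 : ℂ) ^ k = (((2 : ℝ) ^ k : ℝ) : ℂ) := fun k => by push_cast; rfl
  have hp : ∀ k : ℕ, (0 : ℝ) < 2 ^ k := fun k => by positivity
  simp only [HalvingChain, e, Complex.le_def, Complex.lt_def, Complex.re_ofReal_mul,
    Complex.im_ofReal_mul, Complex.zero_re, Complex.zero_im]
  constructor
  · rintro (h | h)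
    · refine ⟨fun m => ?_, Or.inl fun m => ⟨?_, ?_⟩⟩
      · simpa [(hp m).ne'] using (h m).2.2.symm
      · have := (h m).1.1
        rw [pow_succ, mul_assoc] at this
        exact le_of_mul_le_mul_left this (hp m)
      · exact (mul_pos_iff_of_pos_left (hp m)).1 (h m).2.1
    · refine ⟨fun m => ?_, Or.inr fun m => ⟨?_, ?_⟩⟩
      · simpa [(hp m).ne'] using (h m).2.2
      · have := (h m).1.1
        rw [pow_succ, mul_assoc] at this
        exact le_of_mul_le_mul_left this (hp m)
      · exact not_le.1 fun hn => not_le.2 (h m).2.1 (mul_nonneg (hp m).le hn)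
  · rintro ⟨h0, h | h⟩
    · refine Or.inl fun m => ⟨⟨?_, by simp [h0]⟩, mul_pos (hp m) (h m).2, by simp [h0]⟩
      rw [pow_succ, mul_assoc]
      exact mul_le_mul_of_nonneg_left (h m).1 (hp m).le
    · refine Or.inr fun m => ⟨⟨?_, by simp [h0]⟩, mul_neg_of_pos_of_neg (hp m) (h m).2,
        by simp [h0]⟩
      rw [pow_succ, mul_assoc]
      exact mul_le_mul_of_nonneg_left (h m).1 (hp m).le

theorem HalvingChain.real_mul {u : ℕ → ℂ} (hu : HalvingChain u) {c : ℝ} (hc : c ≠ 0) :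
    HalvingChain fun m => (c : ℂ) * u m := by
  rw [halvingChain_iff] at *
  simp only [Complex.re_ofReal_mul, Complex.im_ofReal_mul]
  refine ⟨fun m => by rw [hu.1, mul_zero], ?_⟩
  rcases lt_or_gt_of_ne hc with hc | hc <;> rcases hu.2 with h | h
  · exact Or.inr fun m => ⟨by nlinarith [(h m).1], mul_neg_of_neg_of_pos hc (h m).2⟩
  · exact Or.inl fun m => ⟨by nlinarith [(h m).1], mul_pos_of_neg_of_neg hc (h m).2⟩
  · exact Or.inl fun m => ⟨by nlinarith [(h m).1], mul_pos hc (h m).2⟩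
  · exact Or.inr fun m => ⟨by nlinarith [(h m).1], mul_neg_of_pos_of_neg hc (h m).2⟩

theorem halvingChain_real_mul_iff (u : ℕ → ℂ) {c : ℝ} (hc : c ≠ 0) :
    HalvingChain (fun m => (c : ℂ) * u m) ↔ HalvingChain u := by
  refine ⟨fun h => ?_, fun h => h.real_mul hc⟩
  have h1 := h.real_mul (inv_ne_zero hc)
  simpa [← mul_assoc, hc] using h1

theorem HalvingChain.exists_isHalving {u : ℕ → ℂ} (hu : HalvingChain u) (h0 : u 0 = 1) :
    ∃ h : ℕ → ℝ, IsHalving h ∧ ∀ m, u m = h m := by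
  obtain ⟨him, h⟩ := (halvingChain_iff u).1 hu
  refine ⟨fun m => (u m).re, ?_, fun m => Complex.ext (by simp) (by simp [him])⟩
  rcases h with h | h
  · exact ⟨fun m => (h m).2, by simp [h0], fun m => (h m).1⟩
  · have := (h 0).2
    rw [h0, Complex.one_re] at this
    linarith

end Chain

/-! ### Evaluation of the extremal values -/

section Values

variable {d : ℕ} {x : Fin d → ℂ} {A : Fin d → ℂ} {h : ℕ → ℝ}

/-- The partial products `∏_{m < k} (1 - X^(2^m))`. -/
def thueMorseProd (k : ℕ) (X : ℂ) : ℂ := ∏ m ∈ Finset.range k, (1 - X ^ 2 ^ m)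

theorem thueMorseProd_succ (k : ℕ) (X : ℂ) :
    thueMorseProd (k + 1) X = thueMorseProd k X * (1 - X ^ 2 ^ k) :=
  Finset.prod_range_succ _ _

/-- On `x^(2^k (j+1))` renormalization doubles the exponent and multiplies by `1 - x^(2^k)`. -/
theorem iterate_renorm_drops (hx : ∀ i, x i ≠ 0) (hA : ∀ m, (h m : ℂ) = ∑ i, A i * x i ^ m)
    (k j : ℕ) :
    ((renorm^[k] (drops h) j : ℝ) : ℂ) =
      ∑ i, A i * ((1 - x i) / x i) * thueMorseProd k (x i) * x i ^ (2 ^ k * (j + 1)) := by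
  induction k generalizing j with
  | zero =>
    simp only [Function.iterate_zero, id, drops]
    rw [Complex.ofReal_sub, hA, hA, ← Finset.sum_sub_distrib]
    refine Finset.sum_congr rfl fun i _ => ?_
    have := hx i
    simp only [thueMorseProd, Finset.range_zero, Finset.prod_empty, pow_zero, one_mul, pow_succ]
    field_simp
  | succ k ih =>
    rw [Function.iterate_succ_apply', renorm, Complex.ofReal_sub, ih, ih,
      ← Finset.sum_sub_distrib]
    refine Finset.sum_congr rfl fun i _ => ?_
    rw [thueMorseProd_succ, show 2 ^ k * (2 * j + 2 + 1) = 2 ^ (k + 1) * (j + 1) + 2 ^ k by ring,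
      show 2 ^ k * (2 * j + 1 + 1) = 2 ^ (k + 1) * (j + 1) by ring, pow_add]
    ring

/-- The sum telescopes, since `p_l x^(2^l) = p_l - p_{l+1}` for the partial products `p_l`. -/
theorem sum_iterate_renorm_drops (hx : ∀ i, x i ≠ 0)
    (hA : ∀ m, (h m : ℂ) = ∑ i, A i * x i ^ m) (k : ℕ) :
    ((∑ l ∈ Finset.range k, renorm^[l] (drops h) 0 : ℝ) : ℂ) =
      ∑ i, A i * ((1 - x i) / x i) * (1 - thueMorseProd k (x i)) := by
  induction k with
  | zero => simp [thueMorseProd]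
  | succ k ih =>
    rw [Finset.sum_range_succ, Complex.ofReal_add, ih, iterate_renorm_drops hx hA,
      ← Finset.sum_add_distrib]
    refine Finset.sum_congr rfl fun i _ => ?_
    rw [thueMorseProd_succ, zero_add, mul_one]
    ring

theorem one_sub_pow_ne_zero {X : ℂ} (hX : ‖X‖ < 1) {n : ℕ} (hn : n ≠ 0) : 1 - X ^ n ≠ 0 := by
  intro h
  have h1 := pow_lt_one₀ (norm_nonneg X) hX hn
  rw [← norm_pow, ← sub_eq_zero.1 h, norm_one] at h1
  exact lt_irrefl _ h1

theorem tsum_iterate_renorm_drops (hx : ∀ i, x i ≠ 0) (hx1 : ∀ i, ‖x i‖ < 1)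
    (hA : ∀ m, (h m : ℂ) = ∑ i, A i * x i ^ m) (k : ℕ) :
    ((∑' j, renorm^[k] (drops h) j : ℝ) : ℂ) =
      ∑ i, A i * ((1 - x i) / x i) * thueMorseProd k (x i) *
        (x i ^ 2 ^ k / (1 - x i ^ 2 ^ k)) := by
  rw [Complex.ofReal_tsum]
  simp only [iterate_renorm_drops hx hA]
  refine HasSum.tsum_eq (hasSum_sum fun i _ => ?_)
  have h1 : ‖x i ^ 2 ^ k‖ < 1 := by
    rw [norm_pow]
    exact pow_lt_one₀ (norm_nonneg _) (hx1 i) (by positivity)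
  have h2 := (hasSum_geometric_of_norm_lt_one h1).mul_left
    (A i * ((1 - x i) / x i) * thueMorseProd k (x i) * x i ^ 2 ^ k)
  rw [mul_assoc _ (x i ^ 2 ^ k), ← div_eq_mul_inv] at h2
  have h3 : ∀ j, A i * ((1 - x i) / x i) * thueMorseProd k (x i) * x i ^ (2 ^ k * (j + 1)) =
      A i * ((1 - x i) / x i) * thueMorseProd k (x i) * x i ^ 2 ^ k * (x i ^ 2 ^ k) ^ j := fun j => by
    rw [mul_assoc _ (x i ^ 2 ^ k), ← pow_succ', ← pow_mul]
  simpa only [h3] using h2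

/-- The constant `1` is spread over the summands as `∑ A i`. The denominator `1 + X^(2^k)` remains
after `1 - X^(2^k)` cancels in the geometric sum of ratio `X^(2^(k+1))`. -/
theorem lamFin_succ_eq (hx : ∀ i, x i ≠ 0) (hx1 : ∀ i, ‖x i‖ < 1) (h0 : h 0 = 1)
    (hA : ∀ m, (h m : ℂ) = ∑ i, A i * x i ^ m) (k : ℕ) :
    (((1 - lamFin (drops h) (k + 1)) / 2 : ℝ) : ℂ) = ∑ i, A i * Ek k (x i) := by
  have h1 : ∑ i, A i = 1 := by simpa [h0] using (hA 0).symm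
  have h2 : (lamFin (drops h) (k + 1) : ℂ) =
      -(∑ i, A i * ((1 - x i) / x i) * (1 - thueMorseProd (k + 1) (x i))) +
      ∑ i, A i * ((1 - x i) / x i) * thueMorseProd (k + 1) (x i) *
        (x i ^ 2 ^ (k + 1) / (1 - x i ^ 2 ^ (k + 1))) := by
    rw [lamFin_eq, Complex.ofReal_add, Complex.ofReal_neg, sum_iterate_renorm_drops hx hA,
      tsum_iterate_renorm_drops hx hx1 hA]
  have h3 : (((1 - lamFin (drops h) (k + 1)) / 2 : ℝ) : ℂ) =
      (∑ i, A i - lamFin (drops h) (k + 1)) / 2 := by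
    rw [h1]
    push_cast
    rfl
  rw [h3, h2, ← Finset.sum_neg_distrib, ← Finset.sum_add_distrib,
    ← Finset.sum_sub_distrib, Finset.sum_div]
  refine Finset.sum_congr rfl fun i _ => ?_
  have e1 := hx i
  have e2 : 1 - x i ^ 2 ^ k ≠ 0 := one_sub_pow_ne_zero (hx1 i) (by positivity)
  have e3 : 1 - x i ^ 2 ^ (k + 1) ≠ 0 := one_sub_pow_ne_zero (hx1 i) (by positivity)
  have e4 : x i ^ 2 ^ (k + 1) = (x i ^ 2 ^ k) ^ 2 := by rw [pow_succ, pow_mul]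
  have e5 : 1 + x i ^ 2 ^ k ≠ 0 := fun h => e3 (by rw [e4]; linear_combination (1 - x i ^ 2 ^ k) * h)
  have e6 : ∏ m ∈ Finset.range k, (1 - x i ^ 2 ^ m) = thueMorseProd k (x i) := rfl
  rw [Ek, thueMorseProd_succ, e6, e4]
  rw [e4] at e3
  generalize thueMorseProd k (x i) = p
  generalize x i ^ 2 ^ k = y at *
  field_simp
  ring

theorem tendsto_thueMorseProd {X : ℂ} (hX : ‖X‖ < 1) :
    Tendsto (fun k => thueMorseProd k X) atTop (𝓝 (∏' m : ℕ, (1 - X ^ 2 ^ m))) := by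
  have h1 : Summable fun m : ℕ => ‖-X ^ 2 ^ m‖ := by
    refine Summable.of_nonneg_of_le (fun _ => norm_nonneg _) (fun m => ?_)
      (summable_geometric_of_lt_one (norm_nonneg X) hX)
    rw [norm_neg, norm_pow]
    exact pow_le_pow_of_le_one (norm_nonneg X) hX.le Nat.lt_two_pow_self.le
  have h2 := multipliable_one_add_of_summable h1
  simp only [← sub_eq_add_neg] at h2
  exact h2.hasProd.tendsto_prod_nat

theorem lamInf_drops_eq (hh : IsHalving h) (hx : ∀ i, x i ≠ 0) (hx1 : ∀ i, ‖x i‖ < 1)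
    (hA : ∀ m, (h m : ℂ) = ∑ i, A i * x i ^ m) :
    (((1 - lamInf (drops h)) / 2 : ℝ) : ℂ) = ∑ i, A i * E (x i) := by
  have h1 : ∑ i, A i = 1 := by simpa [hh.zero] using (hA 0).symm
  have h2 := (Complex.continuous_ofReal.tendsto _).comp
    hh.isHalvingWeight.summable_iterate.hasSum.tendsto_sum_nat
  have h3 : Tendsto (fun k => ∑ i, A i * ((1 - x i) / x i) * (1 - thueMorseProd k (x i))) atTop
      (𝓝 (∑ i, A i * ((1 - x i) / x i) * (1 - ∏' m : ℕ, (1 - x i ^ 2 ^ m)))) :=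
    tendsto_finsetSum _ fun i _ => ((tendsto_thueMorseProd (hx1 i)).const_sub 1).const_mul _
  have h4 := tendsto_nhds_unique
    (h2.congr fun k => sum_iterate_renorm_drops hx hA k) h3
  have h5 : (((1 - lamInf (drops h)) / 2 : ℝ) : ℂ) =
      (∑ i, A i + (∑' i, renorm^[i] (drops h) 0 : ℝ)) / 2 := by
    rw [h1, lamInf, sub_neg_eq_add, Complex.ofReal_div, Complex.ofReal_add, Complex.ofReal_one,
      Complex.ofReal_ofNat]
  rw [h5, h4, ← Finset.sum_add_distrib, Finset.sum_div]
  refine Finset.sum_congr rfl fun i _ => ?_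
  have := hx i
  rw [E]
  field_simp
  ring

end Values

/-! ### The spectrum below its least accumulation point -/

section Spectrum

variable {P : ℤ[X]} {h : ℕ → ℝ}

theorem distInt_nonneg (x : ℝ) : 0 ≤ distInt x := abs_nonneg _

theorem distInt_le (x : ℝ) : distInt x ≤ 1 / 2 := abs_sub_round x

theorem limsup_distInt_eq {x : ℕ → ℝ} {a L : ℝ} (ha : 0 < a)
    (hL : IsLiminf (fun n => 1 - 2 * a * distInt (x n)) L) :
    limsup (fun n => distInt (x n)) atTop = (1 - L) / 2 / a := by
  have hb : IsBoundedUnder (· ≤ ·) atTop fun n => distInt (x n) :=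
    isBoundedUnder_of ⟨1 / 2, fun n => distInt_le _⟩
  have hcb : IsCoboundedUnder (· ≤ ·) atTop fun n => distInt (x n) :=
    (isBoundedUnder_of ⟨0, fun n => distInt_nonneg _⟩ :
      IsBoundedUnder (· ≥ ·) atTop fun n => distInt (x n)).isCoboundedUnder_le
  have key : ∀ c, 1 - 2 * a * ((1 - L) / 2 / a + c) = L - 2 * a * c := fun c => by
    field_simp
    ring
  refine le_antisymm (le_of_forall_pos_le_add fun ε hε => limsup_le_of_le hcb ?_)
    (le_of_forall_pos_le_add fun ε hε => ?_)
  · filter_upwards [hL.1 (L - 2 * a * ε) (by nlinarith)] with n hn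
    rw [← key] at hn
    nlinarith
  · rw [← sub_le_iff_le_add]
    refine le_limsup_of_frequently_le ((hL.2 (L + 2 * a * ε) (by nlinarith)).mono fun n hn => ?_) hb
    have := key (-ε)
    nlinarith

theorem IsHalving.mem_spectrumL_imp (hh : IsHalving h)
    (hconv : ∀ j, ∑ k ∈ Finset.range (j + 1), (P.coeff k : ℝ) * h (j - k) =
      if j = 0 then (P.coeff 0 : ℝ) else 0)
    (ha : 0 < |(P.coeff 0 : ℝ)|) {l : ℝ} (hl : l ∈ spectrumL P)
    (hle : l < (1 - lamInf (drops h)) / 2 / |(P.coeff 0 : ℝ)|) :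
    l = 0 ∨ ∃ k, l = (1 - lamFin (drops h) (k + 1)) / 2 / |(P.coeff 0 : ℝ)| := by
  obtain ⟨g, -, hg⟩ := hl
  set a := |(P.coeff 0 : ℝ)| with ha_def
  obtain ⟨s, B, hB, hs⟩ := hh.exists_int_seq hconv (abs_pos.1 ha) g
  rw [← ha_def] at hs
  obtain ⟨c, hlc, hce⟩ := exists_between hle
  have hw := hh.isHalvingWeight
  have hb : IsBoundedUnder (· ≤ ·) atTop fun n => distInt (recSeq P g n) :=
    isBoundedUnder_of ⟨1 / 2, fun n => distInt_le _⟩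
  obtain ⟨N, hN⟩ := eventually_atTop.1 (eventually_lt_of_limsup_lt (hg ▸ hlc) hb)
  have hF : ∀ n, |∑' m, h m * (s (n + m) : ℝ)| = a * distInt (recSeq P g n) := fun n => by
    rw [hs, mul_div_cancel₀ _ ha.ne']
  have hce' : a * c < (1 - lamInf (drops h)) / 2 := by
    rwa [lt_div_iff₀ ha, mul_comm] at hce
  -- The mass is `1`, so `lamInf ≥ -1` and `a * c < 1`, as the two-valued reduction requires.
  have hlam := hw.neg_tsum_le_lamInf
  rw [hh.tsum_drops] at hlam
  obtain ⟨M, τ, hτ⟩ := hh.exists_two_valued (s := fun n => s (n + N)) (B := B) (c := a * c)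
    (fun n => hB _) (by linarith) fun n => by
      have h1 := hF (n + N)
      have h2 : ∀ m, n + m + N = n + N + m := fun m => by ring
      simp only [h2, h1]
      exact mul_le_mul_of_nonneg_left (hN _ (by omega)).le ha.le
  have hcorr : ∀ n, corr (drops h) τ n = 1 - 2 * a * distInt (recSeq P g (n + (M + N))) :=
    fun n => by
      have h1 := hh.abs_tsum_eq_corr hτ n
      have h2 : ∀ m, n + m + M + N = n + (M + N) + m := fun m => by ring
      simp only [h2, hF] at h1
      linarith
  obtain ⟨k, hk⟩ := exists_isLiminf_lamFin hw (a := 1 - 2 * (a * c)) (by linarith) τ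
    (Eventually.of_forall fun n => by
      rw [hcorr]
      nlinarith [hN (n + (M + N)) (by omega)])
  have h3 : l = (1 - lamFin (drops h) k) / 2 / a := by
    rw [hg]
    refine limsup_distInt_eq ha (IsLiminf.of_shift (M + N) ?_)
    rwa [← funext hcorr]
  -- Index `0` is the constant word, whose correlation `1` gives `l = 0`; hence the shift by one.
  rcases k with _ | k
  · left
    rw [h3, lamFin, hh.tsum_drops]
    simp
  · exact Or.inr ⟨k, h3⟩

/-- The differences of the `k`-th morphic image of a constant word serve as `s`. Correlations are at
least `-1`, so the weighted sums are at most `1`, and `|a₀| ≥ 2` brings the quotients within `1/2`.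
-/
theorem IsHalving.mem_spectrumL (hh : IsHalving h)
    (hconv : ∀ j, ∑ k ∈ Finset.range (j + 1), (P.coeff k : ℝ) * h (j - k) =
      if j = 0 then (P.coeff 0 : ℝ) else 0)
    (ha : 2 ≤ |(P.coeff 0 : ℝ)|) {d : ℕ} {α : Fin d → ℂ} (hdeg : P.natDegree = d)
    (hmonic : P.Monic) (hexp : IsExpanding P) (hα : complexRoots P = Finset.univ.val.map α)
    (hinj : Function.Injective α) (k : ℕ) :
    (1 - lamFin (drops h) k) / 2 / |(P.coeff 0 : ℝ)| ∈ spectrumL P := by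
  have ha0 : 0 < |(P.coeff 0 : ℝ)| := by linarith
  have hw := hh.isHalvingWeight
  set τ : ℕ → Bool := morph^[k] fun _ => true with hτ
  set s : ℕ → ℤ := fun n => (if τ n then 1 else 0) - (if τ (n + 1) then 1 else 0) with hs
  have hs' : ∀ n, (s n : ℝ) = (sgn (τ n) - sgn (τ (n + 1))) / 2 := fun n => by
    simp only [hs]
    cases τ n <;> cases τ (n + 1) <;> norm_num
  have hF := hh.abs_tsum_eq_corr hs'
  have hB : ∀ n, |(s n : ℝ)| ≤ 1 := fun n => by
    simp only [hs]
    cases τ n <;> cases τ (n + 1) <;> norm_num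
  have hlow : ∀ n, -1 ≤ corr (drops h) τ n := fun n => by
    have h1 := sgn_mul_tsum_le (fun m => (hw.pos m).le) hw.summable (!τ n)
      fun m => τ (n + 1 + m)
    rw [sgn_not, hh.tsum_drops] at h1
    unfold corr
    linarith
  obtain ⟨g, hg, hgs⟩ := hh.exists_mem_Xi hconv (abs_pos.1 ha0) hdeg hmonic hexp hα hinj hB
    fun n => by
      rw [hF, div_le_iff₀ ha0]
      linarith [hlow n]
  refine ⟨g, hg, (limsup_distInt_eq ha0 ?_).symm⟩
  have h2 : (fun n => 1 - 2 * |(P.coeff 0 : ℝ)| * distInt (recSeq P g n)) =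
      corr (drops h) τ := by
    funext n
    rw [hgs, hF]
    field_simp
    ring
  rw [h2]
  exact isLiminf_iterate_morph hw k

/-- A set that below `e` consists of `0` and of a sequence tending to `e` strictly from below has
`e` as its least accumulation point. -/
theorem isLeast_accPt {L : Set ℝ} {e : ℝ} {ek : ℕ → ℝ} (hL : ∀ l ∈ L, l < e → l = 0 ∨ ∃ k, l = ek k)
    (hek : ∀ k, ek k ∈ L) (hlt : ∀ k, ek k < e) (hlim : Tendsto ek atTop (𝓝 e)) :
    IsLeast {y : ℝ | AccPt y (𝓟 L)} e := by
  constructor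
  · rw [Set.mem_ofPred_eq, accPt_iff_frequently]
    exact hlim.frequently (Frequently.of_forall fun k => ⟨(hlt k).ne, hek k⟩)
  · intro y hy
    by_contra hye
    obtain ⟨c, hyc, hce⟩ := exists_between (not_le.1 hye)
    have h1 := (AccPt.nhds_inter hy (Iio_mem_nhds hyc)).nhds_inter Filter.univ_mem
    rw [Set.univ_inter] at h1
    refine Set.Infinite.of_accPt h1 ?_
    obtain ⟨K, hK⟩ := eventually_atTop.1 (hlim.eventually (lt_mem_nhds hce))
    refine (((Finset.range K).finite_toSet.image ek).insert 0).subset ?_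
    rintro l ⟨hlc, hl⟩
    rcases hL l hl (lt_trans hlc hce) with rfl | ⟨k, rfl⟩
    · exact Set.mem_insert _ _
    · refine Set.mem_insert_of_mem _ ⟨k, ?_, rfl⟩
      by_contra hk
      have := hK k (by simpa using hk)
      exact lt_asymm this hlc

end Spectrum

theorem two_le_abs_coeff_zero {P : ℤ[X]} {d : ℕ} {α : Fin d → ℂ} (hd : 1 ≤ d) (hmonic : P.Monic)
    (hα : complexRoots P = Finset.univ.val.map α) (h1 : ∀ i, 1 < ‖α i‖) :
    2 ≤ |P.coeff 0| := by
  have h2 : (P.coeff 0 : ℂ) = ∏ i, -α i := by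
    have := congrArg (eval 0) (map_eq_prod hmonic hα)
    simpa [eval_prod, ← coeff_zero_eq_eval_zero] using this
  have h3 : ((|P.coeff 0| : ℤ) : ℝ) = ∏ i, ‖α i‖ := by
    have := congrArg norm h2
    rw [norm_prod, Complex.norm_intCast] at this
    simpa using this
  have h4 : (1 : ℝ) < ∏ i, ‖α i‖ := by
    have := Finset.prod_lt_prod_of_nonempty (s := Finset.univ) (f := fun _ : Fin d => (1 : ℝ))
      (g := fun i => ‖α i‖) (fun _ _ => one_pos) (fun i _ => h1 i) ⟨⟨0, hd⟩, Finset.mem_univ _⟩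
    simpa using this
  rw [← h3] at h4
  exact_mod_cast h4

end MarkoffLagrange

end

theorem theorem4p4 (d : ℕ) (hd : 1 ≤ d) (P : ℤ[X]) (hdeg : P.natDegree = d)
    (hmonic : P.Monic)
    (hsimple : (MarkoffLagrange.complexRoots P).Nodup)
    (hexp : MarkoffLagrange.IsExpanding P)
    (α : Fin d → ℂ)
    (hα : MarkoffLagrange.complexRoots P = Finset.univ.val.map α) :
    (MarkoffLagrange.HalvingChain (fun m : ℕ => MarkoffLagrange.rho P (-(m : ℤ))) ↔
      MarkoffLagrange.HalvingChain
        (fun m : ℕ => MarkoffLagrange.completeH m (fun i => (α i)⁻¹))) ∧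
    (MarkoffLagrange.HalvingChain
        (fun m : ℕ => MarkoffLagrange.completeH m (fun i => (α i)⁻¹)) →
      ∃ (e : ℝ) (ek : ℕ → ℝ),
        (e : ℂ) = ((|P.coeff 0| : ℤ) : ℂ)⁻¹ * MarkoffLagrange.Er (fun i => (α i)⁻¹) ∧
        (∀ k, (ek k : ℂ) =
          ((|P.coeff 0| : ℤ) : ℂ)⁻¹ * MarkoffLagrange.Erk k (fun i => (α i)⁻¹)) ∧
        IsLeast {y : ℝ | AccPt y (Filter.principal (MarkoffLagrange.spectrumL P))} e ∧
        MarkoffLagrange.spectrumL P ∩ Set.Ioo 0 e = Set.range ek) := by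
  open MarkoffLagrange in
  have hinj : Function.Injective α := by
    rw [hα, Multiset.nodup_map_iff_inj_on Finset.univ.nodup] at hsimple
    exact fun i j hij => hsimple i (Finset.mem_univ i) j (Finset.mem_univ j) hij
  have h1 : ∀ i, 1 < ‖α i‖ := fun i =>
    hexp _ (hα ▸ Multiset.mem_map_of_mem α (Finset.mem_univ i))
  have h0 : ∀ i, α i ≠ 0 := fun i h => by
    have := h1 i
    rw [h, norm_zero] at this
    linarith
  have ha2 : (2 : ℝ) ≤ |(P.coeff 0 : ℝ)| := by
    have := two_le_abs_coeff_zero hd hmonic hα h1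
    exact_mod_cast this
  have ha : 0 < |(P.coeff 0 : ℝ)| := by linarith
  have ha0 : (P.coeff 0 : ℝ) ≠ 0 := abs_pos.1 ha
  constructor
  · have e : (fun m : ℕ => rho P (-(m : ℤ))) = fun m : ℕ =>
        ((-(P.coeff 0 : ℝ)⁻¹ : ℝ) : ℂ) * completeH m (fun i => (α i)⁻¹) := funext fun m => by
      rw [rho_neg hd hmonic hα hinj h1]
      push_cast
      rfl
    rw [e]
    exact halvingChain_real_mul_iff _ (neg_ne_zero.2 (inv_ne_zero ha0))
  · intro hc
    obtain ⟨h, hh, hH⟩ := hc.exists_isHalving (completeH_zero _)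
    have hA : ∀ m, (h m : ℂ) =
        ∑ i, lagrangeCoeff (fun i => (α i)⁻¹) i * (α i)⁻¹ ^ m := fun m => by
      rw [← hH, completeH_eq_sum hd hinj h0]
    have hx1 : ∀ i, ‖(α i)⁻¹‖ < 1 := fun i => by
      rw [norm_inv]
      exact inv_lt_one_of_one_lt₀ (h1 i)
    have hx : ∀ i, (α i)⁻¹ ≠ 0 := fun i => inv_ne_zero (h0 i)
    have hconv : ∀ j, ∑ k ∈ Finset.range (j + 1), (P.coeff k : ℝ) * h (j - k) =
        if j = 0 then (P.coeff 0 : ℝ) else 0 := fun j => by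
      have h2 := sum_coeff_mul_completeH hmonic hα h0 j
      simp only [hH] at h2
      refine Complex.ofReal_injective ?_
      rw [apply_ite Complex.ofReal]
      push_cast
      exact h2
    have hw := hh.isHalvingWeight
    have hcast : ((|P.coeff 0| : ℤ) : ℂ) = ((|(P.coeff 0 : ℝ)| : ℝ) : ℂ) := by
      rw [← Int.cast_abs, Complex.ofReal_intCast]
    have hlt : ∀ k, (1 - lamFin (drops h) (k + 1)) / 2 / |(P.coeff 0 : ℝ)| <
        (1 - lamInf (drops h)) / 2 / |(P.coeff 0 : ℝ)| := fun k => by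
      rw [div_lt_div_iff_of_pos_right ha]
      linarith [hw.lamInf_lt_lamFin (k + 1)]
    have hpos : ∀ k, 0 < (1 - lamFin (drops h) (k + 1)) / 2 / |(P.coeff 0 : ℝ)| := fun k => by
      have h2 := hw.lamFin_strictAnti (Nat.succ_pos k)
      have h3 : lamFin (drops h) 0 = 1 := hh.tsum_drops
      have : 0 < (1 - lamFin (drops h) (k + 1)) / 2 := by
        simp only [Nat.succ_eq_add_one] at h2
        linarith
      positivity
    have hmem := hh.mem_spectrumL hconv ha2 hdeg hmonic hexp hα hinj
    have himp := fun l (hl : l ∈ spectrumL P) => hh.mem_spectrumL_imp hconv ha hl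
    -- `E^{(k)}` belongs to the word with `k + 1` substitutions.
    refine ⟨(1 - lamInf (drops h)) / 2 / |(P.coeff 0 : ℝ)|,
      fun k => (1 - lamFin (drops h) (k + 1)) / 2 / |(P.coeff 0 : ℝ)|, ?_, fun k => ?_, ?_, ?_⟩
    · rw [Complex.ofReal_div, lamInf_drops_eq hh hx hx1 hA, hcast, div_eq_inv_mul]
      rfl
    · rw [Complex.ofReal_div, lamFin_succ_eq hx hx1 hh.zero hA, hcast, div_eq_inv_mul]
      rfl
    · exact isLeast_accPt himp (fun k => hmem (k + 1)) hlt
        (((hw.tendsto_lamFin.comp (Filter.tendsto_add_atTop_nat 1)).const_sub 1).div_const 2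
          |>.div_const _)
    · ext l
      constructor
      · rintro ⟨hl, hl0, hle⟩
        rcases himp l hl hle with rfl | ⟨k, rfl⟩
        · exact absurd hl0 (lt_irrefl _)
        · exact ⟨k, rfl⟩
      · rintro ⟨k, rfl⟩
        exact ⟨hmem (k + 1), hpos k, hlt k⟩
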